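/- Let $N\ge 1$ and let $S\in\{0,\tfrac12,1,\tfrac32,\dots\}$. Place $N$ spins of size $S$ on the sites $\eta_\alpha=e^{2\pi i\alpha/N}$, $\alpha=1,\dots,N$, of the unit circle, let $\boldsymbol S_\alpha=(S^x_\alpha,S^y_\alpha,S^z_\alpha)$ be the spin operators (spin-$S$ representation, $\boldsymbol S_\alpha^2=S(S+1)$) acting on site $\alpha$ of $(\mathbb C^{2S+1})^{\otimes N}$, and let $\boldsymbol S_{\rm tot}=\sum_\alpha\boldsymbol S_\alpha$. Define the vector operators $$\boldsymbol D_\alpha=\frac12\sum_{\beta\ne\alpha}\frac{\eta_\alpha+\eta_\beta}{\eta_\alpha-\eta_\beta}\Big[i(\boldsymbol S_\alpha\times\boldsymbol S_\beta)+(S+1)\boldsymbol S_\beta-\frac1{S+1}\boldsymbol S_\alpha(\boldsymbol S_\alpha\cdot\boldsymbol S_\beta)\Big],$$ the Hamiltonian $$\tilde H^S=\frac{2\pi^2}{N^2}\Big[\sum_{\alpha\ne\beta}\Big(\frac1{|\eta_\alpha-\eta_\beta|^2}-\frac14\Big)\boldsymbol S_\alpha\cdot\boldsymbol S_\beta-\sum_{\substack{\alpha,\beta,\gamma\\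 \beta\ne\alpha,\ \gamma\ne\alpha}}\Big(\frac1{(\bar\eta_\alpha-\bar\eta_\beta)(\eta_\alpha-\eta_\gamma)}-\frac14\Big)\frac{(\boldsymbol S_\alpha\cdot\boldsymbol S_\beta)(\boldsymbol S_\alpha\cdot\boldsymbol S_\gamma)+(\boldsymbol S_\alpha\cdot\boldsymbol S_\gamma)(\boldsymbol S_\alpha\cdot\boldsymbol S_\beta)}{2(S+1)(2S+3)}\Big]$$ (where $\beta=\gamma$ is allowed in the triple sum), and the number $$\tilde E_0^S=-\frac{\pi^2}{6}\,\frac{S(S+1)^2}{2S+3}\Big(N-\frac4N\Big).$$ Then, with $\boldsymbol D_\alpha^\dagger\boldsymbol D_\alpha=\sum_{i\in\{x,y,z\}}(D^i_\alpha)^\dagger D^i_\alpha$, $$\frac{2\pi^2}{N^2}\Big[\frac1{(2S+1)(2S+3)}\sum_\alpha\boldsymbol D_\alpha^\dagger\boldsymbol D_\alpha+\frac{(S+1)(N-2)}{4(2S+3)}\boldsymbol S_{\rm tot}^2\Big]=\tilde H^S-\tilde E_0^S .$$ Moreover, let $N$ be even and $M=N/2$, let $a_\alpha^\dagger,b_\alpha^\dagger$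 be commuting (Schwinger) boson creation operators with vacuum $|0\rangle$, identify the spin states of a site by $|S,m\rangle=\frac{(a^\dagger)^{S+m}(b^\dagger)^{S-m}}{\sqrt{(S+m)!\,(S-m)!}}|0\rangle$, and put $$|\psi^S_0\rangle=\big(\Psi^{\rm HS}_0[a^\dagger,b^\dagger]\big)^{2S}|0\rangle,\qquad \Psi^{\rm HS}_0[a^\dagger,b^\dagger]=\sum_{\{z_1,\dots,z_M\}}\ \prod_{i<j}(z_i-z_j)^2\prod_{i=1}^M z_i\ \ a^\dagger_{z_1}\cdots a^\dagger_{z_M}\,b^\dagger_{w_1}\cdots b^\dagger_{w_M},$$ where the sum runs over all $M$-element sets of sites and $w_1,\dots,w_M$ are the remaining sites. Then $\tilde H^S$ is Hermitian and $|\psi^S_0\rangle$ is a ground state of $\tilde H^S$ with energy $\tilde E^S_0$: it is nonzero, $\tilde H^S|\psi^S_0\rangle=\tilde E_0^S|\psi^S_0\rangle$, and $\tilde E_0^S$ is the smallest eigenvalue of $\tilde H^S$. -/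

import Mathlib

open scoped Matrix

noncomputable section

namespace SpinChain

/-! ### Single-site spin operators for spin `S = n / 2`

The basis vector with index `k : Fin (n + 1)` is the state `|S, m⟩` with `m = k - S`. -/

/-- The spin quantum number `S = n / 2`. -/
def spin (n : ℕ) : ℝ := (n : ℝ) / 2

/-- `S^z |S, m⟩ = m |S, m⟩`. -/
def szMat (n : ℕ) : Matrix (Fin (n + 1)) (Fin (n + 1)) ℂ :=
  Matrix.diagonal fun k => (((k : ℕ) : ℝ) - spin n : ℝ)

/-- `S^+ |S, m⟩ = √(S(S+1) - m(m+1)) |S, m+1⟩`; for `m = l - S` the number under the root is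
`(n - l) (l + 1)`. -/
def splusMat (n : ℕ) : Matrix (Fin (n + 1)) (Fin (n + 1)) ℂ :=
  Matrix.of fun k l =>
    if (k : ℕ) = (l : ℕ) + 1 then
      ((Real.sqrt (((n : ℝ) - ((l : ℕ) : ℝ)) * (((l : ℕ) : ℝ) + 1)) : ℝ) : ℂ)
    else 0

/-- `S^- = (S^+)†`. -/
def sminusMat (n : ℕ) : Matrix (Fin (n + 1)) (Fin (n + 1)) ℂ := (splusMat n)ᴴ

/-- The spin vector `(S^x, S^y, S^z)`, where `S^± = S^x ± i S^y`. -/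
def spinMat (n : ℕ) : Fin 3 → Matrix (Fin (n + 1)) (Fin (n + 1)) ℂ :=
  ![(1 / 2 : ℂ) • (splusMat n + sminusMat n),
    (1 / (2 * Complex.I)) • (splusMat n - sminusMat n),
    szMat n]

/-! ### The chain with `N` sites -/

/-- Labels of the product basis of the `N`-fold tensor product of the spin-`n / 2` space. -/
abbrev Config (N n : ℕ) : Type := Fin N → Fin (n + 1)

/-- State vectors, in coordinates with respect to the orthonormal product basis. -/
abbrev State (N n : ℕ) : Type := Config N n → ℂ

/-- Linear operators on the Hilbert space of the chain. -/
abbrev Op (N n : ℕ) : Type := Matrix (Config N n) (Config N n) ℂ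

/-- Vector operators (three Cartesian components). -/
abbrev VecOp (N n : ℕ) : Type := Fin 3 → Op N n

/-- `1 ⊗ ⋯ ⊗ A ⊗ ⋯ ⊗ 1` with `A` acting on the site `α`. -/
def siteOp {N n : ℕ} (α : Fin N) (A : Matrix (Fin (n + 1)) (Fin (n + 1)) ℂ) : Op N n :=
  Matrix.of fun σ τ => if ∀ β, β ≠ α → σ β = τ β then A (σ α) (τ α) else 0

/-- The spin vector operator `𝐒_α` of site `α`. -/
def siteSpin (N n : ℕ) (α : Fin N) : VecOp N n := fun i => siteOp α (spinMat n i)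

/-- The total spin `𝐒_tot = ∑_α 𝐒_α`. -/
def totalSpin (N n : ℕ) : VecOp N n := ∑ α, siteSpin N n α

/-- The scalar product `𝐒_α · 𝐒_β`. -/
def spinDot (N n : ℕ) (α β : Fin N) : Op N n := siteSpin N n α ⬝ᵥ siteSpin N n β

/-- The cross product of vector operators, with the order of the factors kept;
indices are taken modulo 3. -/
def crossOp {N n : ℕ} (A B : VecOp N n) : VecOp N n := fun i =>
  A (i + 1) * B (i + 2) - A (i + 2) * B (i + 1)

/-- The site coordinates `η_α = exp(2πiα/N)`, `α = 1, …, N`, on the unit circle;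
the element `α : Fin N` stands for the site number `α + 1`. -/
def site (N : ℕ) (α : Fin N) : ℂ :=
  Complex.exp (2 * Real.pi * Complex.I * (((α : ℕ) + 1 : ℕ) : ℂ) / (N : ℂ))

/-! ### The operators `𝐃_α`, the Hamiltonian and the energy -/

/-- `𝐃_α = ½ ∑_{β ≠ α} (η_α + η_β)/(η_α - η_β)
  [ i (𝐒_α × 𝐒_β) + (S+1) 𝐒_β - (1/(S+1)) 𝐒_α (𝐒_α · 𝐒_β) ]`. -/
def dOp (N n : ℕ) (α : Fin N) : VecOp N n := fun i =>
  (1 / 2 : ℂ) • ∑ β ∈ Finset.univ.erase α,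
    ((site N α + site N β) / (site N α - site N β)) •
      (Complex.I • crossOp (siteSpin N n α) (siteSpin N n β) i
        + ((spin n + 1 : ℝ) : ℂ) • siteSpin N n β i
        - ((1 / (spin n + 1) : ℝ) : ℂ) • (siteSpin N n α i * spinDot N n α β))

/-- `𝐃_α† · 𝐃_α`, the sum over the three components of (adjoint times component). -/
def dDaggerD (N n : ℕ) (α : Fin N) : Op N n := ∑ i, (dOp N n α i)ᴴ * dOp N n α i

/-- The modified Hamiltonian. The sites `β` and `γ` in the triple sum both differ from `α`, but
may coincide. -/
def hTilde (N n : ℕ) : Op N n :=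
  ((2 * Real.pi ^ 2 / (N : ℝ) ^ 2 : ℝ) : ℂ) •
    (∑ α, ∑ β ∈ Finset.univ.erase α,
        ((1 / ‖site N α - site N β‖ ^ 2 - 1 / 4 : ℝ) : ℂ) • spinDot N n α β
      - ∑ α, ∑ β ∈ Finset.univ.erase α, ∑ γ ∈ Finset.univ.erase α,
          (1 / ((star (site N α) - star (site N β)) * (site N α - site N γ)) - 1 / 4) •
            ((1 / (2 * (spin n + 1) * (2 * spin n + 3)) : ℝ) : ℂ) •
              (spinDot N n α β * spinDot N n α γ + spinDot N n α γ * spinDot N n α β))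

/-- The energy `-(π²/6) · S (S+1)² / (2S+3) · (N - 4/N)`. -/
def eTilde (N n : ℕ) : ℝ :=
  -(Real.pi ^ 2 / 6) * (spin n * (spin n + 1) ^ 2 / (2 * spin n + 3)) * ((N : ℝ) - 4 / (N : ℝ))

/-! ### The spin liquid state

The Fock space generated from the vacuum `|0⟩ = 1` by the Schwinger boson creation operators
`a_α†`, `b_α†` is the polynomial ring in the variables `X (Sum.inl α)` (for `a_α†`) and
`X (Sum.inr α)` (for `b_α†`), the creation operators being multiplications by the variables. -/

/-- Polynomials in the creation operators `a_α†`, `b_α†`. -/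
abbrev Fock (N : ℕ) : Type := MvPolynomial (Fin N ⊕ Fin N) ℂ

/-- The Haldane–Shastry amplitude `∏_{i<j} (z_i - z_j)² ∏_i z_i` of the configuration in which the
up spins occupy the set `Z` of sites. -/
def hsAmplitude (N : ℕ) (Z : Finset (Fin N)) : ℂ :=
  (∏ p ∈ (Z ×ˢ Z).filter (fun p => p.1 < p.2), (site N p.1 - site N p.2) ^ 2) *
    ∏ α ∈ Z, site N α

/-- The polynomial `Ψ^HS[a†, b†]`: the sum over all sets of `M = N / 2` sites occupied by up
spins (`a†`), the remaining sites being occupied by down spins (`b†`). -/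
def hsPoly (N : ℕ) : Fock N :=
  ∑ Z ∈ (Finset.univ : Finset (Fin N)).powersetCard (N / 2),
    MvPolynomial.C (hsAmplitude N Z) *
      ((∏ α ∈ Z, MvPolynomial.X (Sum.inl α)) * ∏ α ∈ Zᶜ, MvPolynomial.X (Sum.inr α))

/-- The occupation numbers of the product state `σ`: on site `α` there are `S + m = σ α` bosons
of type `a` and `S - m = n - σ α` bosons of type `b`. -/
def occupation {N n : ℕ} (σ : Config N n) : (Fin N ⊕ Fin N) →₀ ℕ :=
  Finsupp.equivFunOnFinite.symm
    (Sum.elim (fun α => (σ α : ℕ)) (fun α => n - (σ α : ℕ)))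

/-- The coordinates, in the product basis, of a Fock state with `n` bosons on every site, where
`|S, m⟩ = (a†)^(S+m) (b†)^(S-m) |0⟩ / √((S+m)! (S-m)!)`. -/
def fockToState (N n : ℕ) (P : Fock N) : State N n := fun σ =>
  P.coeff (occupation σ) *
    ((∏ α, Real.sqrt (((σ α : ℕ).factorial : ℝ) * ((n - (σ α : ℕ)).factorial : ℝ)) : ℝ) : ℂ)

/-- The spin liquid state `|ψ^S_0⟩ = (Ψ^HS[a†, b†])^{2S} |0⟩`, with `2S = n`. -/
def psi0 (N n : ℕ) : State N n := fockToState N n (hsPoly N ^ n)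

/-- `v` is a ground state, with energy `E`, of the Hermitian operator `H`: a nonzero eigenvector
for the eigenvalue `E`, and `E` is the smallest eigenvalue of `H`. -/
def IsGroundState {N n : ℕ} (H : Op N n) (E : ℝ) (v : State N n) : Prop :=
  H.IsHermitian ∧ v ≠ 0 ∧ H *ᵥ v = (E : ℂ) • v ∧
    ∀ μ : ℝ, Module.End.HasEigenvalue (Matrix.toLin' H) (μ : ℂ) → E ≤ μ

end SpinChain

end

/-!
For a spin `S` the operator coefficients of `𝐃_α` form a matrix which is `2S + 1` times the
orthogonal projection of `ℂ³ ⊗ V_S` onto its component of spin `S + 1`. Hence `𝐃_α† 𝐃_α` is that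
same matrix sandwiched between two copies of `∑_β θ_αβ 𝐒_β`, where `θ_αβ = (η_α + η_β) / (η_α -
η_β)`. After summation over `α`, the identity `θ_αβ θ_βγ + θ_βγ θ_γα + θ_γα θ_αβ = -1` for
distinct sites and sums over roots of unity turn the terms of first and second order in `𝐒_α` into
the Hamiltonian, a multiple of `𝐒_tot²` and a constant.

For the ground state it must be shown that `𝐃_α` and `𝐒_tot` annihilate `Ψ^n |0⟩`, where `n = 2S`.
On bosons the projection onto spin `S + 1` is the multiplication `Sym² ⊗ Symⁿ → Symⁿ⁺²`, so `𝐃_α`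
is governed by a single derivation `W` of the Fock space, the contraction of `∑_β θ_αβ 𝐒_β` with
the triplet of quadratic polynomials at the site `α`. Since `W` is a derivation, `W Ψ = 0`
suffices, for every `S` at once. As `Ψ` is a singlet, `W Ψ` is a highest weight vector of degree
three at `α`, so it vanishes as soon as its component with three bosons of type `a` does; this
component is a sum over one coordinate of polynomials in it without a constant term and of degree
less than `N`, which vanishes at the roots of unity.
-/

noncomputable section

namespace SpinChain

/-! ### The sites and the coefficients of `𝐃_α` -/

section Theta

variable {K : Type*} [Field K]

/-- The coefficient `(x + y) / (x - y)` of `𝐃_α`, as a function of two points of the unit circle;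
it is `0` on the diagonal by the convention for division by zero. -/
def theta (x y : K) : K := (x + y) / (x - y)

@[simp]
theorem theta_self (x : K) : theta x x = 0 := by simp [theta]

theorem theta_swap (x y : K) : theta y x = -theta x y := by
  rw [theta, theta, ← div_neg, neg_sub, add_comm]

theorem theta_inv_inv {x y : K} (hx : x ≠ 0) (hy : y ≠ 0) : theta x⁻¹ y⁻¹ = -theta x y := by
  rw [← theta_swap, theta, theta, ← mul_div_mul_left _ _ (mul_ne_zero hx hy)]
  congr 1 <;> field_simp

theorem theta_reflection {x y : K} (hx : x ≠ 0) (hy : y ≠ 0) :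
    theta x (x * x / y) = -theta x y := by
  rw [← theta_swap, theta, theta, ← mul_div_mul_left (y + x) (y - x) (div_ne_zero hx hy)]
  congr 1 <;> field_simp

theorem theta_mul_theta {x y z : K} (hxy : x ≠ y) (hxz : x ≠ z) (hyz : y ≠ z) :
    theta x y * theta x z = 1 + theta y z * (theta x y + theta z x) := by
  have h₁ := sub_ne_zero.2 hxy
  have h₂ := sub_ne_zero.2 hxz
  have h₃ := sub_ne_zero.2 hyz
  rw [theta_swap x z]
  simp only [theta]
  field_simp
  ring

theorem inv_sub_inv_mul_sub_sub_quarter [CharZero K] {x y z : K} (hx : x ≠ 0) (hy : y ≠ 0)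
    (hxy : x ≠ y) (hxz : x ≠ z) :
    1 / ((x⁻¹ - y⁻¹) * (x - z)) - 1 / 4 =
      1 / 4 * (theta x z - theta x y - theta x y * theta x z) := by
  have h₁ := sub_ne_zero.2 hxy
  have h₂ := sub_ne_zero.2 hxz
  have inv_sub : x⁻¹ - y⁻¹ = -(x - y) / (x * y) := by
    field_simp
    ring
  rw [inv_sub]
  simp only [theta]
  field_simp
  ring

end Theta

theorem sum_eval_pow_of_isPrimitiveRoot {R : Type*} [CommRing R] [IsDomain R] {ζ : R} {N : ℕ}
    (hζ : IsPrimitiveRoot ζ N) {p : Polynomial R} (hp : p.natDegree < N) :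
    ∑ i ∈ Finset.range N, p.eval (ζ ^ i) = N * p.coeff 0 := by
  have power_sum : ∀ k ∈ Finset.range N, k ≠ 0 → ∑ i ∈ Finset.range N, (ζ ^ i) ^ k = 0 := by
    intro k hk hk0
    have hζk : (ζ ^ k) ^ N = 1 := by rw [← pow_mul, mul_comm, pow_mul, hζ.pow_eq_one, one_pow]
    have hne : ζ ^ k - 1 ≠ 0 :=
      sub_ne_zero.2 (hζ.pow_ne_one_of_pos_of_lt hk0 (Finset.mem_range.1 hk))
    refine (mul_eq_zero.1 ?_).resolve_right hne
    simp_rw [← pow_mul, mul_comm _ k, pow_mul]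
    rw [geom_sum_mul, hζk, sub_self]
  simp_rw [Polynomial.eval_eq_sum_range' hp]
  rw [Finset.sum_comm, Finset.sum_eq_single 0]
  · simp
  · intro k hk hk0
    rw [← Finset.mul_sum, power_sum k hk hk0, mul_zero]
  · intro h0
    simp only [Finset.mem_range, not_lt, Nat.le_zero] at h0
    omega

section Site

variable {N : ℕ}

theorem site_ne_zero (α : Fin N) : site N α ≠ 0 := Complex.exp_ne_zero _

theorem site_eq_pow (α : Fin N) :
    site N α = Complex.exp (2 * Real.pi * Complex.I / N) ^ ((α : ℕ) + 1) := by
  rw [site, ← Complex.exp_nat_mul]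
  congr 1
  push_cast
  ring

theorem isPrimitiveRoot_exp_of_fin (α : Fin N) :
    IsPrimitiveRoot (Complex.exp (2 * Real.pi * Complex.I / N)) N :=
  Complex.isPrimitiveRoot_exp N α.pos.ne'

theorem site_injective : Function.Injective (site N) := by
  intro α β h
  rw [site_eq_pow, site_eq_pow, pow_succ, pow_succ] at h
  exact Fin.ext ((isPrimitiveRoot_exp_of_fin α).pow_inj α.2 β.2
    (mul_right_cancel₀ (Complex.exp_ne_zero _) h))

theorem star_site (α : Fin N) : star (site N α) = (site N α)⁻¹ := by
  have hζ : ‖Complex.exp (2 * Real.pi * Complex.I / N)‖ = 1 :=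
    (isPrimitiveRoot_exp_of_fin α).norm'_eq_one α.pos.ne'
  rw [Complex.star_def, Complex.inv_eq_conj (by rw [site_eq_pow, norm_pow, hζ, one_pow])]

theorem sum_eval_site {p : Polynomial ℂ} (hp : p.natDegree < N) :
    ∑ α, p.eval (site N α) = N * p.coeff 0 := by
  have hζ : IsPrimitiveRoot (Complex.exp (2 * Real.pi * Complex.I / N)) N :=
    Complex.isPrimitiveRoot_exp N (Nat.ne_zero_of_lt hp)
  have cyclic := (Finset.sum_range_succ' (fun i =>
    p.eval (Complex.exp (2 * Real.pi * Complex.I / N) ^ i)) N).symm.trans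
      (Finset.sum_range_succ _ N)
  rw [hζ.pow_eq_one, pow_zero, add_left_inj] at cyclic
  simp_rw [site_eq_pow]
  rw [Fin.sum_univ_eq_sum_range
    (fun i => p.eval (Complex.exp (2 * Real.pi * Complex.I / N) ^ (i + 1))), cyclic,
    sum_eval_pow_of_isPrimitiveRoot hζ hp]

theorem site_reflection [NeZero N] (α β : Fin N) :
    site N (α + α - β) = site N α * site N α / site N β := by
  have site_add : ∀ γ δ : Fin N,
      site N (γ + δ) * Complex.exp (2 * Real.pi * Complex.I / N) = site N γ * site N δ := by
    intro γ δ
    rw [site_eq_pow, site_eq_pow, site_eq_pow, pow_succ _ ((γ + δ : Fin N) : ℕ), Fin.val_add,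
      ← pow_eq_pow_mod _ (isPrimitiveRoot_exp_of_fin γ).pow_eq_one]
    ring
  rw [eq_div_iff (site_ne_zero β), ← site_add, ← site_add, sub_add_cancel]

/-- The weights `θ_{αβ} = (η_α + η_β) / (η_α - η_β)` of `𝐃_α`, as a function of the site `β`. -/
def siteTheta (N : ℕ) (α : Fin N) : Fin N → ℂ := fun β => theta (site N α) (site N β)

@[simp]
theorem siteTheta_self (α : Fin N) : siteTheta N α α = 0 := theta_self _

theorem siteTheta_swap (α β : Fin N) : siteTheta N β α = -siteTheta N α β := theta_swap _ _

theorem star_siteTheta (α : Fin N) : star (siteTheta N α) = -siteTheta N α := by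
  ext β
  have h : star (theta (site N α) (site N β)) = theta (star (site N α)) (star (site N β)) := by
    simp only [theta, star_div₀, star_add, star_sub]
  rw [Pi.star_apply, Pi.neg_apply, siteTheta, h, star_site, star_site,
    theta_inv_inv (site_ne_zero α) (site_ne_zero β)]

theorem sum_siteTheta (α : Fin N) : ∑ β, siteTheta N α β = 0 := by
  have : NeZero N := ⟨α.pos.ne'⟩
  have reflection : ∀ β, siteTheta N α (α + α - β) = -siteTheta N α β := fun β => by
    rw [siteTheta, siteTheta, site_reflection,
      theta_reflection (site_ne_zero α) (site_ne_zero β)]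
  refine self_eq_neg.1 ?_
  rw [← Finset.sum_neg_distrib, ← Equiv.sum_comp (Equiv.subLeft (α + α))]
  exact Finset.sum_congr rfl fun β _ => reflection β

theorem sum_siteTheta_left (β : Fin N) : ∑ α, siteTheta N α β = 0 := by
  simp_rw [siteTheta_swap β, Finset.sum_neg_distrib, sum_siteTheta, neg_zero]

theorem sum_siteTheta_mul_siteTheta_of_ne {β γ : Fin N} (h : β ≠ γ) :
    ∑ α, siteTheta N α β * siteTheta N α γ = (N : ℂ) - 2 + 2 * siteTheta N β γ ^ 2 := by
  have three_term : ∀ α, siteTheta N α β * siteTheta N α γ =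
      1 + siteTheta N β γ * (siteTheta N α β + siteTheta N γ α)
        - (if α = β then 1 - siteTheta N β γ ^ 2 else 0)
        - (if α = γ then 1 - siteTheta N β γ ^ 2 else 0) := by
    intro α
    rcases eq_or_ne α β with rfl | hαβ
    · simp only [siteTheta_self, siteTheta_swap α γ, if_true, if_neg h]
      ring
    rcases eq_or_ne α γ with rfl | hαγ
    · simp only [siteTheta_self, siteTheta_swap β α, if_true, if_neg hαβ]
      ring
    rw [if_neg hαβ, if_neg hαγ, sub_zero, sub_zero]
    exact theta_mul_theta (site_injective.ne hαβ) (site_injective.ne hαγ) (site_injective.ne h)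
  simp_rw [three_term]
  simp only [Finset.sum_sub_distrib, Finset.sum_add_distrib, ← Finset.mul_sum, sum_siteTheta,
    sum_siteTheta_left, Finset.sum_ite_eq', Finset.mem_univ, if_true, Finset.sum_const,
    Finset.card_univ, Fintype.card_fin, nsmul_eq_mul]
  ring

theorem sum_siteTheta_mul_siteTheta (β γ : Fin N) :
    ∑ α, siteTheta N α β * siteTheta N α γ = (N : ℂ) - 2 + 2 * siteTheta N β γ ^ 2
      + if β = γ then ∑ α, siteTheta N β α ^ 2 - ((N : ℂ) - 2) else 0 := by
  rcases eq_or_ne β γ with rfl | h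
  · simp only [siteTheta_self, if_true, ← sq, fun α => siteTheta_swap β α, neg_sq]
    ring
  · rw [sum_siteTheta_mul_siteTheta_of_ne h, if_neg h, add_zero]

theorem sum_sum_siteTheta_sq (N : ℕ) :
    ∑ α, ∑ β, siteTheta N α β ^ 2 = -((N : ℂ) * (N - 1) * (N - 2) / 3) := by
  have total : ∑ β, ∑ γ, ∑ α, siteTheta N α β * siteTheta N α γ = 0 := by
    rw [Finset.sum_congr rfl fun β _ => Finset.sum_comm, Finset.sum_comm]
    refine Finset.sum_eq_zero fun α _ => ?_
    rw [← Finset.sum_mul_sum, sum_siteTheta, zero_mul]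
  simp_rw [sum_siteTheta_mul_siteTheta, Finset.sum_add_distrib, Finset.sum_ite_eq,
    Finset.mem_univ, if_true, Finset.sum_sub_distrib, ← Finset.mul_sum] at total
  simp only [Finset.sum_const, Finset.card_univ, Fintype.card_fin, nsmul_eq_mul] at total
  linear_combination total / 3

theorem inv_star_sub_mul_sub_sub_quarter {α β γ : Fin N} (hβ : α ≠ β) (hγ : α ≠ γ) :
    1 / ((star (site N α) - star (site N β)) * (site N α - site N γ)) - 1 / 4 =
      1 / 4 * (siteTheta N α γ - siteTheta N α β - siteTheta N α β * siteTheta N α γ) := by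
  rw [star_site, star_site]
  exact inv_sub_inv_mul_sub_sub_quarter (site_ne_zero α) (site_ne_zero β)
    (site_injective.ne hβ) (site_injective.ne hγ)

theorem inv_norm_sq_sub_quarter {α β : Fin N} (h : α ≠ β) :
    ((1 / ‖site N α - site N β‖ ^ 2 - 1 / 4 : ℝ) : ℂ) = -(1 / 4) * siteTheta N α β ^ 2 := by
  push_cast
  rw [← Complex.conj_mul', ← Complex.star_def, star_sub, inv_star_sub_mul_sub_sub_quarter h h]
  ring

end Site

/-! ### Vector operators -/

section VectorOperators

/-- The cross product of triples over a possibly noncommutative ring, with the order of the factors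
kept; `crossOp` is the case of vector operators of the chain. Mathlib's `crossProduct` is
restricted to commutative rings. -/
def cross {A : Type*} [Mul A] [Sub A] (u v : Fin 3 → A) : Fin 3 → A := fun i =>
  u (i + 1) * v (i + 2) - u (i + 2) * v (i + 1)

/-- The Cartesian components of a vector operator with ladder components `p`, `m` and third
component `z`. -/
def ofLadder {V : Type*} [AddCommGroup V] [Module ℂ V] (p m z : V) : Fin 3 → V :=
  ![(1 / 2 : ℂ) • (p + m), (1 / (2 * Complex.I)) • (p - m), z]

theorem map_ofLadder {V W : Type*} [AddCommGroup V] [Module ℂ V] [AddCommGroup W] [Module ℂ W]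
    (φ : V →ₗ[ℂ] W) (p m z : V) (i : Fin 3) :
    φ (ofLadder p m z i) = ofLadder (φ p) (φ m) (φ z) i := by
  fin_cases i <;> simp [ofLadder]

theorem sum_ofLadder_apply {ι V : Type*} [AddCommGroup V] [Module ℂ V] (s : Finset ι)
    (p m z : ι → V) (i : Fin 3) : ∑ j ∈ s, ofLadder (p j) (m j) (z j) i =
      ofLadder (∑ j ∈ s, p j) (∑ j ∈ s, m j) (∑ j ∈ s, z j) i := by
  fin_cases i <;> simp [ofLadder, ← Finset.smul_sum, Finset.sum_add_distrib]

theorem one_div_two_mul_I : 1 / (2 * Complex.I) = -(Complex.I / 2) := by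
  rw [one_div, mul_inv, Complex.inv_I]
  ring

variable {A : Type*} [Ring A]

/-- The matrix of the linear map `v ↦ S × v`. -/
def crossMat (S : Fin 3 → A) : Matrix (Fin 3) (Fin 3) A :=
  !![0, -S 2, S 1; S 2, 0, -S 0; -S 1, S 0, 0]

theorem crossMat_mulVec (S v : Fin 3 → A) : crossMat S *ᵥ v = cross S v := by
  ext i
  fin_cases i <;> simp [crossMat, cross, Matrix.mulVec, dotProduct, Fin.sum_univ_three] <;> abel

theorem vecMul_crossMat (S v : Fin 3 → A) : v ᵥ* crossMat S = cross v S := by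
  ext i
  fin_cases i <;> simp [crossMat, cross, Matrix.vecMul, dotProduct, Fin.sum_univ_three] <;> abel

variable [Algebra ℂ A]

theorem cross_ofLadder {p m z : A} (hpm : p * m - m * p = (2 : ℂ) • z) (hzp : z * p - p * z = p)
    (hzm : z * m - m * z = -m) :
    cross (ofLadder p m z) (ofLadder p m z) = Complex.I • ofLadder p m z := by
  have hI : Complex.I * -(Complex.I / 2) = 1 / 2 := by
    linear_combination (-1 / 2 : ℂ) * Complex.I_mul_I
  ext i
  fin_cases i <;>
    simp only [ofLadder, cross, one_div_two_mul_I, Pi.smul_apply, Fin.zero_eta, Fin.mk_one,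
      Fin.reduceFinMk, Fin.reduceAdd, Fin.isValue, zero_add, Matrix.cons_val, smul_mul_assoc,
      mul_smul_comm, mul_add, mul_sub, add_mul, sub_mul, smul_smul, hI]
  · linear_combination (norm := module) (Complex.I / 2) • hzp - (Complex.I / 2) • hzm
  · linear_combination (norm := module) (1 / 2 : ℂ) • hzp + (1 / 2 : ℂ) • hzm
  · linear_combination (norm := module) (Complex.I / 2) • hpm

theorem ofLadder_dotProduct_ofLadder (P M Z p m z : A) :
    ofLadder P M Z ⬝ᵥ ofLadder p m z = (1 / 2 : ℂ) • (P * m + M * p) + Z * z := by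
  have hI : -(Complex.I / 2) * -(Complex.I / 2) = -(1 / 4) := by
    linear_combination (1 / 4 : ℂ) * Complex.I_mul_I
  simp only [dotProduct, Fin.sum_univ_three, ofLadder, one_div_two_mul_I, Matrix.cons_val,
    smul_mul_smul_comm, hI, mul_add, mul_sub, add_mul, sub_mul]
  module

theorem star_ofLadder {V : Type*} [AddCommGroup V] [Module ℂ V] [StarAddMonoid V] [StarModule ℂ V]
    {p z : V} (hz : IsSelfAdjoint z) :
    star (ofLadder p (star p) z) = ofLadder p (star p) z := by
  ext i
  fin_cases i
  · simp [ofLadder, add_comm]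
  · simp only [ofLadder, one_div_two_mul_I, Pi.star_apply, Fin.mk_one, Matrix.cons_val, star_smul,
      star_sub, star_star]
    rw [← neg_sub p, smul_neg, ← neg_smul]
    simp [neg_div]
  · exact hz

theorem crossMat_mul_crossMat {S : Fin 3 → A} {c : ℂ} (hS : cross S S = Complex.I • S)
    (hc : S ⬝ᵥ S = c • 1) :
    crossMat S * crossMat S =
      Matrix.vecMulVec S S + Complex.I • crossMat S - c • (1 : Matrix (Fin 3) (Fin 3) A) := by
  have h₀ : S 1 * S 2 - S 2 * S 1 = Complex.I • S 0 := congrFun hS 0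
  have h₁ : S 2 * S 0 - S 0 * S 2 = Complex.I • S 1 := congrFun hS 1
  have h₂ : S 0 * S 1 - S 1 * S 0 = Complex.I • S 2 := congrFun hS 2
  have hd : S 0 * S 0 + S 1 * S 1 + S 2 * S 2 = c • 1 := by
    rw [← hc, dotProduct, Fin.sum_univ_three]
  ext i j
  fin_cases i <;> fin_cases j <;>
    simp [crossMat, Matrix.mul_apply, Fin.sum_univ_three, Matrix.vecMulVec_apply, ← h₀, ← h₁,
      ← h₂, ← hd] <;>
    abel

/-- `2s + 1` times the orthogonal projection of `ℂ³ ⊗ V_s` onto its component of spin `s + 1`,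
where `S` is the spin operator of the spin `s` module `V_s`. It is the matrix of the linear map
`v ↦ i (S × v) + (s+1) v - (s+1)⁻¹ S (S · v)` which occurs in `𝐃_α`. -/
def topSpinMatrix (s : ℝ) (S : Fin 3 → A) : Matrix (Fin 3) (Fin 3) A :=
  Complex.I • crossMat S + ((s : ℂ) + 1) • (1 : Matrix (Fin 3) (Fin 3) A)
    - ((s : ℂ) + 1)⁻¹ • Matrix.vecMulVec S S

theorem topSpinMatrix_mulVec (s : ℝ) (S v : Fin 3 → A) :
    topSpinMatrix s S *ᵥ v = Complex.I • cross S v + ((s : ℂ) + 1) • v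
      - ((s : ℂ) + 1)⁻¹ • fun i => S i * (S ⬝ᵥ v) := by
  rw [topSpinMatrix, Matrix.sub_mulVec, Matrix.add_mulVec, Matrix.smul_mulVec, Matrix.smul_mulVec,
    Matrix.smul_mulVec, Matrix.one_mulVec, crossMat_mulVec]
  congr 2
  ext i
  simp only [Matrix.mulVec, dotProduct, Matrix.vecMulVec_apply, Finset.mul_sum, mul_assoc]

theorem topSpinMatrix_ofLadder_mulVec (s : ℝ) (P M Z p m z : A) :
    topSpinMatrix s (ofLadder P M Z) *ᵥ ofLadder p m z =
      ofLadder
        (P * z - Z * p + ((s : ℂ) + 1) • p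
          - ((s : ℂ) + 1)⁻¹ • (P * ((1 / 2 : ℂ) • (P * m + M * p) + Z * z)))
        (Z * m - M * z + ((s : ℂ) + 1) • m
          - ((s : ℂ) + 1)⁻¹ • (M * ((1 / 2 : ℂ) • (P * m + M * p) + Z * z)))
        ((1 / 2 : ℂ) • (M * p - P * m) + ((s : ℂ) + 1) • z
          - ((s : ℂ) + 1)⁻¹ • (Z * ((1 / 2 : ℂ) • (P * m + M * p) + Z * z))) := by
  have hI : Complex.I * (Complex.I / 2) = -(1 / 2) := by
    linear_combination (1 / 2 : ℂ) * Complex.I_mul_I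
  have hI' : Complex.I * (1 / 2 * (Complex.I / 2)) = -(1 / 4) := by
    linear_combination (1 / 2 : ℂ) * hI
  rw [topSpinMatrix_mulVec, ofLadder_dotProduct_ofLadder]
  ext i
  fin_cases i <;>
    simp only [ofLadder, cross, one_div_two_mul_I, Pi.add_apply, Pi.sub_apply, Pi.smul_apply,
      Fin.zero_eta, Fin.mk_one, Fin.reduceFinMk, Fin.reduceAdd, Fin.isValue, zero_add,
      Matrix.cons_val, smul_mul_assoc, mul_smul_comm, mul_add, mul_sub, add_mul, sub_mul,
      smul_add, smul_sub, smul_smul, mul_neg, neg_mul, mul_comm (Complex.I / 2), hI, hI'] <;>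
    module

theorem topSpinMatrix_mul_self {s : ℝ} {S : Fin 3 → A} (hs : (s : ℂ) + 1 ≠ 0)
    (hS : cross S S = Complex.I • S) (hdot : S ⬝ᵥ S = ((s : ℂ) * (s + 1)) • 1) :
    topSpinMatrix s S * topSpinMatrix s S = (2 * (s : ℂ) + 1) • topSpinMatrix s S := by
  have hXX := crossMat_mul_crossMat hS hdot
  have hXR : crossMat S * Matrix.vecMulVec S S = Complex.I • Matrix.vecMulVec S S := by
    rw [Matrix.mul_vecMulVec, crossMat_mulVec, hS, Matrix.smul_vecMulVec]
  have hRX : Matrix.vecMulVec S S * crossMat S = Complex.I • Matrix.vecMulVec S S := by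
    rw [Matrix.vecMulVec_mul, vecMul_crossMat, hS]
    ext i j
    simp [Matrix.vecMulVec_apply]
  have hRR : Matrix.vecMulVec S S * Matrix.vecMulVec S S =
      ((s : ℂ) * (s + 1)) • Matrix.vecMulVec S S := by
    rw [Matrix.vecMulVec_mul_vecMulVec, hdot]
    ext i j
    simp [Matrix.vecMulVec_apply]
  simp only [topSpinMatrix, mul_add, add_mul, mul_sub, sub_mul, smul_mul_smul_comm, mul_one,
    one_mul, hXX, hXR, hRX, hRR, Complex.I_mul_I]
  match_scalars
  · field_simp
    linear_combination -2 * Complex.I_sq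
  · field_simp
    ring
  · field_simp
    ring

theorem dotProduct_topSpinMatrix_mulVec (s : ℝ) {S v w : Fin 3 → A}
    (hcomm : ∀ i j, Commute (v i) (S j)) (hv : cross v v = Complex.I • w) :
    v ⬝ᵥ (topSpinMatrix s S *ᵥ v) =
      S ⬝ᵥ w + ((s : ℂ) + 1) • (v ⬝ᵥ v) - ((s : ℂ) + 1)⁻¹ • ((S ⬝ᵥ v) * (S ⬝ᵥ v)) := by
  have triple : v ⬝ᵥ cross S v = -(S ⬝ᵥ cross v v) := by
    simp only [dotProduct, Fin.sum_univ_three, cross, mul_sub, ← mul_assoc, (hcomm _ _).eq,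
      Fin.isValue, Fin.reduceAdd, zero_add]
    abel
  have projection : (v ⬝ᵥ fun i => S i * (S ⬝ᵥ v)) = (S ⬝ᵥ v) * (S ⬝ᵥ v) := by
    simp only [dotProduct, Finset.sum_mul, ← mul_assoc, (hcomm _ _).eq]
  rw [topSpinMatrix_mulVec, dotProduct_sub, dotProduct_add, dotProduct_smul, dotProduct_smul,
    dotProduct_smul, triple, projection, hv, dotProduct_smul, smul_neg, smul_smul,
    Complex.I_mul_I, neg_one_smul, neg_neg]

variable [StarRing A] [StarModule ℂ A]

theorem conjTranspose_topSpinMatrix (s : ℝ) {S : Fin 3 → A} (hS : star S = S) :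
    (topSpinMatrix s S)ᴴ = topSpinMatrix s S := by
  have hS' : ∀ i, star (S i) = S i := congrFun hS
  have hX : (crossMat S)ᴴ = -crossMat S := by
    ext i j
    fin_cases i <;> fin_cases j <;> simp [crossMat, hS']
  rw [topSpinMatrix, Matrix.conjTranspose_sub, Matrix.conjTranspose_add,
    Matrix.conjTranspose_smul, Matrix.conjTranspose_smul, Matrix.conjTranspose_smul,
    Matrix.conjTranspose_vecMulVec, Matrix.conjTranspose_one, hX, hS]
  simp

theorem star_dotProduct_topSpinMatrix_mulVec {s : ℝ} {S : Fin 3 → A} (hs : (s : ℂ) + 1 ≠ 0)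
    (hstar : star S = S) (hS : cross S S = Complex.I • S)
    (hdot : S ⬝ᵥ S = ((s : ℂ) * (s + 1)) • 1) (v : Fin 3 → A) :
    star (topSpinMatrix s S *ᵥ v) ⬝ᵥ (topSpinMatrix s S *ᵥ v) =
      (2 * (s : ℂ) + 1) • (star v ⬝ᵥ (topSpinMatrix s S *ᵥ v)) := by
  rw [Matrix.star_mulVec, conjTranspose_topSpinMatrix s hstar, ← Matrix.dotProduct_mulVec,
    Matrix.mulVec_mulVec, topSpinMatrix_mul_self hs hS hdot, Matrix.smul_mulVec,
    dotProduct_smul]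

end VectorOperators

/-! ### The spin operators of the chain -/

section SpinMatrices

variable (n : ℕ)

theorem sminusMat_apply (k l : Fin (n + 1)) : sminusMat n k l = splusMat n l k := by
  simp only [sminusMat, Matrix.conjTranspose_apply, splusMat, Matrix.of_apply]
  split_ifs <;> simp

theorem sminusMat_eq_submatrix_rev :
    sminusMat n = (splusMat n).submatrix Fin.rev Fin.rev := by
  ext k l
  rw [sminusMat_apply, Matrix.submatrix_apply, splusMat, Matrix.of_apply, Matrix.of_apply]
  simp only [Fin.val_rev]
  by_cases h : (l : ℕ) = k + 1
  · rw [if_pos h, if_pos (by omega), Nat.add_sub_add_right, Nat.cast_sub (by omega : (l : ℕ) ≤ n),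
      h]
    push_cast
    ring_nf
  · rw [if_neg h, if_neg (by omega)]

theorem sminusMat_mul_splusMat : sminusMat n * splusMat n =
    Matrix.diagonal fun k : Fin (n + 1) => ((n : ℂ) - (k : ℕ)) * ((k : ℕ) + 1) := by
  ext k l
  simp only [Matrix.mul_apply, sminusMat_apply, splusMat, Matrix.of_apply, Matrix.diagonal_apply]
  rcases (Fin.is_le k).eq_or_lt with hk | hk
  · rw [Finset.sum_eq_zero]
    · simp [hk]
    · intro j _
      rw [if_neg (by omega), zero_mul]
  rw [Finset.sum_eq_single (⟨k + 1, by omega⟩ : Fin (n + 1))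
    (fun j _ hj => by rw [if_neg (fun h => hj (Fin.ext h)), zero_mul]) (by simp)]
  simp only [if_true, add_left_inj, Fin.val_inj]
  split_ifs with h
  · have hn : (0 : ℝ) ≤ n - (k : ℕ) := sub_nonneg.2 (by exact_mod_cast hk.le)
    rw [← h, ← Complex.ofReal_mul, Real.mul_self_sqrt (by positivity)]
    push_cast
    ring
  · rw [mul_zero]

theorem splusMat_mul_sminusMat : splusMat n * sminusMat n =
    Matrix.diagonal fun k : Fin (n + 1) => ((n : ℂ) + 1 - (k : ℕ)) * (k : ℕ) := by
  have hplus : splusMat n = (sminusMat n).submatrix Fin.rev Fin.rev := by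
    rw [sminusMat_eq_submatrix_rev, Matrix.submatrix_submatrix, Fin.rev_involutive.comp_self,
      Matrix.submatrix_id_id]
  calc splusMat n * sminusMat n
      = (sminusMat n).submatrix Fin.rev Fin.rev * (splusMat n).submatrix Fin.rev Fin.rev := by
        rw [← hplus, ← sminusMat_eq_submatrix_rev]
    _ = (sminusMat n * splusMat n).submatrix Fin.rev Fin.rev :=
        Matrix.submatrix_mul_equiv _ _ _ Fin.revPerm _
    _ = _ := by
        rw [sminusMat_mul_splusMat, Matrix.submatrix_diagonal _ _ Fin.rev_injective]
        congr 1
        ext k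
        simp only [Function.comp_apply, Fin.val_rev, Nat.add_sub_add_right,
          Nat.cast_sub (Fin.is_le k)]
        ring

theorem isSelfAdjoint_szMat : IsSelfAdjoint (szMat n) := by
  rw [IsSelfAdjoint, Matrix.star_eq_conjTranspose, szMat, Matrix.diagonal_conjTranspose]
  congr 1
  ext k
  simp

theorem splusMat_mul_sminusMat_sub :
    splusMat n * sminusMat n - sminusMat n * splusMat n = (2 : ℂ) • szMat n := by
  rw [splusMat_mul_sminusMat, sminusMat_mul_splusMat, szMat, Matrix.diagonal_sub,
    ← Matrix.diagonal_smul]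
  congr 1
  ext k
  simp [spin]
  ring

theorem szMat_mul_splusMat_sub :
    szMat n * splusMat n - splusMat n * szMat n = splusMat n := by
  ext k l
  rw [Matrix.sub_apply, szMat, Matrix.diagonal_mul, Matrix.mul_diagonal, splusMat, Matrix.of_apply]
  split_ifs with h
  · rw [h]
    push_cast
    ring
  · simp

theorem szMat_mul_sminusMat_sub :
    szMat n * sminusMat n - sminusMat n * szMat n = -sminusMat n := by
  have h := congrArg star (szMat_mul_splusMat_sub n)
  rw [star_sub, star_mul, star_mul, (isSelfAdjoint_szMat n).star_eq] at h
  rw [← neg_sub]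
  exact congrArg _ h

theorem spinMat_eq_ofLadder : spinMat n = ofLadder (splusMat n) (sminusMat n) (szMat n) := rfl

theorem star_spinMat : star (spinMat n) = spinMat n :=
  star_ofLadder (isSelfAdjoint_szMat n)

theorem cross_spinMat : cross (spinMat n) (spinMat n) = Complex.I • spinMat n :=
  cross_ofLadder (splusMat_mul_sminusMat_sub n) (szMat_mul_splusMat_sub n)
    (szMat_mul_sminusMat_sub n)

theorem spinMat_dotProduct_self :
    spinMat n ⬝ᵥ spinMat n = ((spin n : ℂ) * (spin n + 1)) • 1 := by
  rw [spinMat_eq_ofLadder, ofLadder_dotProduct_ofLadder, splusMat_mul_sminusMat,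
    sminusMat_mul_splusMat, szMat, Matrix.diagonal_mul_diagonal, Matrix.diagonal_add,
    ← Matrix.diagonal_smul, Matrix.diagonal_add, ← Matrix.diagonal_one, ← Matrix.diagonal_smul]
  congr 1
  ext k
  simp [spin]
  ring

end SpinMatrices

section SiteOperators

variable {N n : ℕ}

theorem siteOp_mulVec (α : Fin N) (A : Matrix (Fin (n + 1)) (Fin (n + 1)) ℂ)
    (v : State N n) (σ : Config N n) :
    (siteOp α A *ᵥ v) σ = ∑ k, A (σ α) k * v (Function.update σ α k) := by
  symm
  refine Fintype.sum_of_injective (Function.update σ α) (Function.update_injective σ α) _ _ ?_ ?_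
  · intro τ hτ
    simp only [siteOp, Matrix.of_apply]
    rw [if_neg, zero_mul]
    exact fun h => hτ ⟨τ α, (Function.eq_update_iff.2 ⟨rfl, fun β hβ => (h β hβ).symm⟩).symm⟩
  · intro k
    simp only [siteOp, Matrix.of_apply, Function.update_self]
    rw [if_pos fun β hβ => (Function.update_of_ne hβ _ _).symm]

theorem siteOp_one (α : Fin N) : siteOp α (1 : Matrix (Fin (n + 1)) (Fin (n + 1)) ℂ) = 1 := by
  refine Matrix.mulVec_injective (funext fun v => funext fun σ => ?_)
  simp [siteOp_mulVec, Matrix.one_apply]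

theorem siteOp_mul (α : Fin N) (A B : Matrix (Fin (n + 1)) (Fin (n + 1)) ℂ) :
    siteOp α (A * B) = siteOp α A * siteOp α B := by
  refine Matrix.mulVec_injective (funext fun v => funext fun σ => ?_)
  rw [← Matrix.mulVec_mulVec]
  simp only [siteOp_mulVec, Function.update_self, Function.update_idem, Matrix.mul_apply,
    Finset.mul_sum, Finset.sum_mul]
  rw [Finset.sum_comm]
  simp only [mul_assoc]

/-- The embedding of the operators of the site `α` into the operators of the chain. -/
def siteAlgHom (N n : ℕ) (α : Fin N) :
    Matrix (Fin (n + 1)) (Fin (n + 1)) ℂ →ₐ[ℂ] Op N n :=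
  AlgHom.ofLinearMap
    { toFun := siteOp α
      map_add' := fun A B => by
        ext σ τ
        simp only [siteOp, Matrix.of_apply, Matrix.add_apply]
        split_ifs <;> simp
      map_smul' := fun c A => by
        ext σ τ
        simp only [siteOp, Matrix.of_apply, Matrix.smul_apply, RingHom.id_apply]
        split_ifs <;> simp }
    (siteOp_one α) (siteOp_mul α)

theorem star_siteOp (α : Fin N) (A : Matrix (Fin (n + 1)) (Fin (n + 1)) ℂ) :
    star (siteOp α A) = siteOp α (star A) := by
  ext σ τ
  simp only [siteOp, Matrix.of_apply, Matrix.star_apply, eq_comm (a := τ _)]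
  split_ifs <;> simp

theorem commute_siteOp {α β : Fin N} (h : α ≠ β) (A B : Matrix (Fin (n + 1)) (Fin (n + 1)) ℂ) :
    Commute (siteOp α A) (siteOp β B) := by
  refine Matrix.mulVec_injective (funext fun v => funext fun σ => ?_)
  rw [← Matrix.mulVec_mulVec, ← Matrix.mulVec_mulVec]
  simp only [siteOp_mulVec, Finset.mul_sum, Function.update_of_ne h, Function.update_of_ne h.symm]
  rw [Finset.sum_comm]
  refine Finset.sum_congr rfl fun k _ => Finset.sum_congr rfl fun l _ => ?_
  rw [Function.update_comm h]
  ring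

theorem siteSpin_eq (α : Fin N) : siteSpin N n α = fun i => siteAlgHom N n α (spinMat n i) := rfl

theorem star_siteSpin (α : Fin N) : star (siteSpin N n α) = siteSpin N n α := by
  ext1 i
  rw [Pi.star_apply, siteSpin, star_siteOp]
  exact congrArg _ (congrFun (star_spinMat n) i)

theorem commute_siteSpin {α β : Fin N} (h : α ≠ β) (i j : Fin 3) :
    Commute (siteSpin N n α i) (siteSpin N n β j) := commute_siteOp h _ _

theorem cross_siteSpin (α : Fin N) :
    cross (siteSpin N n α) (siteSpin N n α) = Complex.I • siteSpin N n α := by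
  ext1 i
  simp only [siteSpin_eq, cross, Pi.smul_apply, ← map_mul, ← map_sub, ← map_smul]
  exact congrArg _ (congrFun (cross_spinMat n) i)

theorem siteSpin_dotProduct_self (α : Fin N) :
    siteSpin N n α ⬝ᵥ siteSpin N n α = ((spin n : ℂ) * (spin n + 1)) • 1 := by
  rw [← map_one (siteAlgHom N n α), ← map_smul, ← spinMat_dotProduct_self, siteSpin_eq]
  simp only [dotProduct, map_sum, map_mul]

/-- The vector operator `∑_β f_β 𝐒_β`: it is the total spin for `f = 1`, and `𝐃_α` is a projection
of it for `f_β = θ_{αβ}`. -/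
def weightedSpin (N n : ℕ) (f : Fin N → ℂ) : VecOp N n := ∑ β, f β • siteSpin N n β

theorem weightedSpin_apply (f : Fin N → ℂ) (i : Fin 3) :
    weightedSpin N n f i = ∑ β, f β • siteSpin N n β i := by
  simp only [weightedSpin, Finset.sum_apply, Pi.smul_apply]

theorem totalSpin_eq_weightedSpin : totalSpin N n = weightedSpin N n 1 := by
  simp only [totalSpin, weightedSpin, Pi.one_apply, one_smul]

theorem siteSpin_dotProduct_weightedSpin (α : Fin N) (f : Fin N → ℂ) :
    siteSpin N n α ⬝ᵥ weightedSpin N n f = ∑ β, f β • spinDot N n α β := by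
  simp only [weightedSpin, dotProduct_sum, dotProduct_smul, spinDot]

theorem star_weightedSpin (f : Fin N → ℂ) :
    star (weightedSpin N n f) = weightedSpin N n (star f) := by
  ext1 i
  have hS : ∀ β, star (siteSpin N n β i) = siteSpin N n β i := fun β =>
    congrFun (star_siteSpin β) i
  simp only [Pi.star_apply, weightedSpin_apply, star_sum, star_smul, hS]

theorem commute_weightedSpin_siteSpin {f : Fin N → ℂ} {α : Fin N} (hf : f α = 0) (i j : Fin 3) :
    Commute (weightedSpin N n f i) (siteSpin N n α j) := by
  rw [weightedSpin_apply]
  refine Commute.sum_left _ _ _ fun β _ => ?_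
  rcases eq_or_ne β α with rfl | h
  · rw [hf, zero_smul]
    exact Commute.zero_left _
  · exact (commute_siteSpin h i j).smul_left _

theorem cross_weightedSpin (f : Fin N → ℂ) :
    cross (weightedSpin N n f) (weightedSpin N n f) = Complex.I • weightedSpin N n (f * f) := by
  ext1 i
  simp only [cross, weightedSpin_apply, Pi.smul_apply, Finset.sum_mul_sum, Finset.smul_sum]
  rw [Finset.sum_comm (f := fun β γ => f β • siteSpin N n β (i + 2) * f γ • siteSpin N n γ (i + 1)),
    ← Finset.sum_sub_distrib]
  refine Finset.sum_congr rfl fun β _ => ?_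
  rw [← Finset.sum_sub_distrib, Finset.sum_eq_single β]
  · rw [smul_mul_smul_comm, smul_mul_smul_comm, ← smul_sub, Pi.mul_apply, smul_comm Complex.I]
    exact congrArg _ (congrFun (cross_siteSpin β) i)
  · intro γ _ h
    rw [smul_mul_smul_comm, smul_mul_smul_comm, (commute_siteSpin h _ _).eq, mul_comm, sub_self]
  · simp

theorem weightedSpin_dotProduct_weightedSpin (f g : Fin N → ℂ) :
    weightedSpin N n f ⬝ᵥ weightedSpin N n g =
      ∑ β, ∑ γ, (f β * g γ) • spinDot N n β γ := by
  simp only [weightedSpin, sum_dotProduct, smul_dotProduct]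
  simp only [dotProduct_sum, dotProduct_smul, Finset.smul_sum, smul_smul, spinDot]

end SiteOperators

/-! ### The operator identity -/

section OperatorIdentity

variable {N n : ℕ}

theorem spin_add_one_ne_zero (n : ℕ) : (spin n : ℂ) + 1 ≠ 0 := by
  rw [spin]
  norm_cast
  positivity

theorem two_mul_spin_add_one_ne_zero (n : ℕ) : 2 * (spin n : ℂ) + 1 ≠ 0 := by
  rw [spin]
  norm_cast
  positivity

theorem two_mul_spin_add_three_ne_zero (n : ℕ) : 2 * (spin n : ℂ) + 3 ≠ 0 := by
  rw [spin]
  norm_cast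
  positivity

theorem dOp_eq (α : Fin N) : dOp N n α = (1 / 2 : ℂ) •
    (topSpinMatrix (spin n) (siteSpin N n α) *ᵥ weightedSpin N n (siteTheta N α)) := by
  ext1 i
  rw [dOp, Pi.smul_apply, weightedSpin, Matrix.mulVec_sum, Finset.sum_apply]
  refine congrArg _ ((Finset.sum_congr rfl fun β _ => ?_).trans (Finset.sum_erase _ ?_))
  · rw [Matrix.mulVec_smul, topSpinMatrix_mulVec]
    push_cast
    rw [one_div]
    rfl
  · rw [siteTheta_self, zero_smul, Matrix.mulVec_zero, Pi.zero_apply]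

theorem dDaggerD_eq_star_dotProduct (α : Fin N) :
    dDaggerD N n α = star (dOp N n α) ⬝ᵥ dOp N n α := rfl

theorem dDaggerD_eq (α : Fin N) : dDaggerD N n α = (-(2 * (spin n : ℂ) + 1) / 4) •
    ((∑ β, siteTheta N α β ^ 2 • spinDot N n α β)
      + ((spin n : ℂ) + 1) •
        (weightedSpin N n (siteTheta N α) ⬝ᵥ weightedSpin N n (siteTheta N α))
      - ((spin n : ℂ) + 1)⁻¹ • ((∑ β, siteTheta N α β • spinDot N n α β) *
          ∑ β, siteTheta N α β • spinDot N n α β)) := by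
  have skew : star (weightedSpin N n (siteTheta N α)) = -weightedSpin N n (siteTheta N α) := by
    rw [star_weightedSpin, star_siteTheta]
    simp only [weightedSpin, Pi.neg_apply, neg_smul, Finset.sum_neg_distrib]
  have quadratic := dotProduct_topSpinMatrix_mulVec (spin n)
    (commute_weightedSpin_siteSpin (n := n) (siteTheta_self α)) (cross_weightedSpin _)
  simp only [siteSpin_dotProduct_weightedSpin, ← sq, Pi.pow_apply] at quadratic
  rw [dDaggerD_eq_star_dotProduct, dOp_eq, star_smul, smul_dotProduct, dotProduct_smul,
    star_dotProduct_topSpinMatrix_mulVec (spin_add_one_ne_zero n) (star_siteSpin α)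
      (cross_siteSpin α) (siteSpin_dotProduct_self α), skew, neg_dotProduct, quadratic]
  simp only [sq, star_div₀, star_one, star_ofNat]
  module

theorem sum_sum_antisymm_smul {ι A : Type*} [Ring A] [Algebra ℂ A] (s : Finset ι) (t : ι → ℂ)
    (f : ι → A) (c : ℂ) :
    ∑ β ∈ s, ∑ γ ∈ s, (1 / 4 * (t γ - t β - t β * t γ)) • c • (f β * f γ + f γ * f β) =
      (-(c * (1 / 2))) • ((∑ β ∈ s, t β • f β) * ∑ β ∈ s, t β • f β) := by
  have expand : ∀ β γ, (1 / 4 * (t γ - t β - t β * t γ)) • c • (f β * f γ + f γ * f β) =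
      (c / 4) • (f β * t γ • f γ + t γ • f γ * f β - t β • f β * f γ - f γ * t β • f β
        - t β • f β * t γ • f γ - t γ • f γ * t β • f β) := by
    intro β γ
    simp only [smul_mul_assoc, mul_smul_comm]
    module
  simp only [expand, ← Finset.smul_sum, Finset.sum_sub_distrib, Finset.sum_add_distrib,
    ← Finset.mul_sum, ← Finset.sum_mul]
  module

theorem sum_erase_inv_norm_sq_smul_spinDot (α : Fin N) :
    ∑ β ∈ Finset.univ.erase α,
        ((1 / ‖site N α - site N β‖ ^ 2 - 1 / 4 : ℝ) : ℂ) • spinDot N n α β =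
      (-(1 / 4) : ℂ) • ∑ β, siteTheta N α β ^ 2 • spinDot N n α β := by
  rw [Finset.smul_sum, ← Finset.sum_erase Finset.univ (a := α) (by simp)]
  refine Finset.sum_congr rfl fun β hβ => ?_
  rw [inv_norm_sq_sub_quarter (Finset.ne_of_mem_erase hβ).symm, smul_smul]

theorem sum_erase_sum_erase_smul_anticommutator (α : Fin N) (c : ℂ) :
    ∑ β ∈ Finset.univ.erase α, ∑ γ ∈ Finset.univ.erase α,
        (1 / ((star (site N α) - star (site N β)) * (site N α - site N γ)) - 1 / 4) • c •
          (spinDot N n α β * spinDot N n α γ + spinDot N n α γ * spinDot N n α β) =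
      (-(c * (1 / 2))) • ((∑ β, siteTheta N α β • spinDot N n α β) *
        ∑ β, siteTheta N α β • spinDot N n α β) := by
  rw [← Finset.sum_erase (f := fun β => siteTheta N α β • spinDot N n α β) Finset.univ (a := α)
    (by simp), ← sum_sum_antisymm_smul]
  refine Finset.sum_congr rfl fun β hβ => Finset.sum_congr rfl fun γ hγ => ?_
  rw [inv_star_sub_mul_sub_sub_quarter (Finset.ne_of_mem_erase hβ).symm
    (Finset.ne_of_mem_erase hγ).symm]

theorem hTilde_eq (N n : ℕ) : hTilde N n = ((2 * Real.pi ^ 2 / (N : ℝ) ^ 2 : ℝ) : ℂ) •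
    ((-(1 / 4) : ℂ) • (∑ α, ∑ β, siteTheta N α β ^ 2 • spinDot N n α β)
      + (1 / (4 * ((spin n : ℂ) + 1) * (2 * spin n + 3))) •
        ∑ α, (∑ β, siteTheta N α β • spinDot N n α β) *
          ∑ β, siteTheta N α β • spinDot N n α β) := by
  have h₁ := spin_add_one_ne_zero n
  have h₃ := two_mul_spin_add_three_ne_zero n
  simp only [hTilde, sum_erase_inv_norm_sq_smul_spinDot, sum_erase_sum_erase_smul_anticommutator,
    ← Finset.smul_sum]
  push_cast
  match_scalars
  · ring
  · field_simp
    ring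

theorem sum_weightedSpin_siteTheta_dotProduct_self (N n : ℕ) :
    ∑ α, weightedSpin N n (siteTheta N α) ⬝ᵥ weightedSpin N n (siteTheta N α) =
      ((N : ℂ) - 2) • (totalSpin N n ⬝ᵥ totalSpin N n)
        + (2 : ℂ) • (∑ α, ∑ β, siteTheta N α β ^ 2 • spinDot N n α β)
        - ((N : ℂ) * (N - 2) * (N + 2) / 3 * (spin n * (spin n + 1))) • (1 : Op N n) := by
  have spinDot_self : ∀ β, spinDot N n β β = ((spin n : ℂ) * (spin n + 1)) • (1 : Op N n) :=
    siteSpin_dotProduct_self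
  simp only [totalSpin_eq_weightedSpin, weightedSpin_dotProduct_weightedSpin, Pi.one_apply, mul_one,
    one_smul]
  rw [Finset.sum_comm, Finset.sum_congr rfl fun β _ => Finset.sum_comm]
  simp only [← Finset.sum_smul, sum_siteTheta_mul_siteTheta]
  simp only [add_smul, Finset.sum_add_distrib, ite_smul, zero_smul, Finset.sum_ite_eq,
    Finset.mem_univ, if_true, spinDot_self, ← Finset.smul_sum, mul_smul]
  rw [← Finset.sum_smul, Finset.sum_sub_distrib, sum_sum_siteTheta_sq]
  simp only [Finset.sum_const, Finset.card_univ, Fintype.card_fin, nsmul_eq_mul]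
  module

theorem sum_dDaggerD_add_totalSpin_sq (hN : N ≠ 0) :
    ((2 * Real.pi ^ 2 / (N : ℝ) ^ 2 : ℝ) : ℂ) •
        (((1 / ((2 * spin n + 1) * (2 * spin n + 3)) : ℝ) : ℂ) • ∑ α, dDaggerD N n α
          + (((spin n + 1) * ((N : ℝ) - 2) / (4 * (2 * spin n + 3)) : ℝ) : ℂ) •
            (totalSpin N n ⬝ᵥ totalSpin N n))
      = hTilde N n - ((eTilde N n : ℝ) : ℂ) • (1 : Op N n) := by
  have h₁ := spin_add_one_ne_zero n
  have h₂ := two_mul_spin_add_one_ne_zero n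
  have h₃ := two_mul_spin_add_three_ne_zero n
  have h₄ : (N : ℂ) ≠ 0 := Nat.cast_ne_zero.2 hN
  simp only [hTilde_eq, dDaggerD_eq, ← Finset.smul_sum, Finset.sum_sub_distrib,
    Finset.sum_add_distrib, sum_weightedSpin_siteTheta_dotProduct_self, eTilde]
  push_cast
  match_scalars <;> field_simp <;> ring

end OperatorIdentity

/-! ### Second quantization -/

section SecondQuantization

open MvPolynomial

variable {σ R : Type*} [CommRing R]

theorem pderiv_pderiv_comm (i j : σ) (P : MvPolynomial σ R) :
    pderiv i (pderiv j P) = pderiv j (pderiv i P) := by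
  classical
  have h : ⁅pderiv (R := R) i, pderiv j⁆ = 0 := derivation_ext fun k => by
    rw [Derivation.commutator_apply, pderiv_X, pderiv_X, Pi.single_apply, Pi.single_apply]
    split_ifs <;> simp
  rw [← sub_eq_zero, ← Derivation.commutator_apply, h, Derivation.zero_apply]

theorem coeff_X_mul_pderiv_of_add_eq {i j : σ} {m m' : σ →₀ ℕ}
    (h : m + Finsupp.single j 1 = m' + Finsupp.single i 1) (P : MvPolynomial σ R) :
    coeff m (X i * pderiv j P) = (m' j : R) * coeff m' P := by
  classical
  rw [coeff_X_mul']
  split_ifs with hi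
  · obtain ⟨q, rfl⟩ := le_iff_exists_add'.1
      (Finsupp.single_le_iff.2 (Nat.one_le_iff_ne_zero.2 (Finsupp.mem_support_iff.1 hi)))
    obtain rfl : q + Finsupp.single j 1 = m' := by
      rw [add_right_comm] at h
      exact add_right_cancel h
    rw [add_tsub_cancel_right, coeff_pderiv, Finsupp.add_apply, Finsupp.single_eq_same, mul_comm]
    push_cast
    rfl
  · have hmi : m i = 0 := Finsupp.notMem_support_iff.1 hi
    have hij : j = i := by
      by_contra hne
      have := DFunLike.congr_fun h i
      simp [hmi, Finsupp.single_eq_of_ne' hne] at this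
    obtain rfl : m = m' := add_right_cancel (hij ▸ h)
    rw [hij, hmi, Nat.cast_zero, zero_mul]

theorem coeff_X_mul_pderiv (i : σ) (m : σ →₀ ℕ) (P : MvPolynomial σ R) :
    coeff m (X i * pderiv i P) = (m i : R) * coeff m P :=
  coeff_X_mul_pderiv_of_add_eq rfl P

theorem derivation_sum_apply {ι : Type*} (s : Finset ι)
    (D : ι → Derivation R (MvPolynomial σ R) (MvPolynomial σ R)) (P : MvPolynomial σ R) :
    (∑ i ∈ s, D i) P = ∑ i ∈ s, D i P := by
  rw [← Derivation.coeFnAddMonoidHom_apply, map_sum, Finset.sum_apply]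
  rfl

theorem derivation_prod {ι : Type*} [DecidableEq ι]
    (D : Derivation R (MvPolynomial σ R) (MvPolynomial σ R)) (s : Finset ι)
    (g : ι → MvPolynomial σ R) :
    D (∏ i ∈ s, g i) = ∑ i ∈ s, (∏ j ∈ s.erase i, g j) * D (g i) := by
  induction s using Finset.induction_on with
  | empty => simp
  | insert i s hi ih =>
    rw [Finset.prod_insert hi, Derivation.leibniz, ih, Finset.sum_insert hi,
      Finset.erase_insert hi, smul_eq_mul, smul_eq_mul, Finset.mul_sum, add_comm]
    congr 1
    refine Finset.sum_congr rfl fun j hj => ?_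
    have hij : i ≠ j := fun h => hi (h ▸ hj)
    rw [Finset.erase_insert_of_ne hij, Finset.prod_insert fun h => hi (Finset.mem_of_mem_erase h),
      mul_assoc]

variable [Fintype σ]

/-- The second quantization `∑_{ij} A_{ij} x_i ∂_j` of the matrix `A`, acting on the polynomials
in the creation operators `x_i` as the derivation which extends `A`. -/
def secondQuant :
    Matrix σ σ R →ₗ[R] Derivation R (MvPolynomial σ R) (MvPolynomial σ R) where
  toFun A := mkDerivation R fun j => ∑ i, A i j • X i
  map_add' A B := derivation_ext fun j => by simp [add_smul, Finset.sum_add_distrib]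
  map_smul' c A := derivation_ext fun j => by simp [mul_smul, Finset.smul_sum]

@[simp]
theorem secondQuant_X (A : Matrix σ σ R) (j : σ) : secondQuant A (X j) = ∑ i, A i j • X i :=
  mkDerivation_X _ _ _

theorem secondQuant_apply (A : Matrix σ σ R) (P : MvPolynomial σ R) :
    secondQuant A P = ∑ j, ∑ i, A i j • (X i * pderiv j P) := by
  classical
  have h : secondQuant A = ∑ j, (∑ i, A i j • X i : MvPolynomial σ R) • pderiv j :=
    derivation_ext fun k => by
      rw [secondQuant_X, derivation_sum_apply]
      simp [pderiv_X, Pi.single_apply]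
  rw [h, derivation_sum_apply]
  simp [Finset.sum_mul]

theorem secondQuant_secondQuant (A B : Matrix σ σ R) (P : MvPolynomial σ R) :
    secondQuant A (secondQuant B P) =
      secondQuant B (secondQuant A P) + secondQuant (A * B - B * A) P := by
  have h : ⁅secondQuant A, secondQuant B⁆ = secondQuant (A * B - B * A) :=
    derivation_ext fun k => by
      simp only [Derivation.commutator_apply, secondQuant_X, map_sum, Derivation.map_smul,
        Finset.smul_sum, smul_smul, Matrix.sub_apply, Matrix.mul_apply, sub_smul, Finset.sum_smul,
        Finset.sum_sub_distrib]
      congr 1 <;>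
        exact Finset.sum_comm.trans
          (Finset.sum_congr rfl fun _ _ => Finset.sum_congr rfl fun _ _ => by rw [mul_comm])
  rw [← h, Derivation.commutator_apply, add_sub_cancel]

theorem pderiv_secondQuant (A : Matrix σ σ R) (i : σ) (P : MvPolynomial σ R) :
    pderiv i (secondQuant A P) = secondQuant A (pderiv i P) + ∑ j, A i j • pderiv j P := by
  classical
  simp only [secondQuant_apply, map_sum, Derivation.map_smul, pderiv_mul, smul_add,
    Finset.sum_add_distrib, pderiv_X, Pi.single_apply, pderiv_pderiv_comm i, ite_mul, one_mul,
    zero_mul, smul_ite, smul_zero, Finset.sum_ite_eq', Finset.mem_univ, if_true]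
  rw [add_comm]

end SecondQuantization

/-! ### Schwinger bosons -/

section SchwingerBosons

open MvPolynomial

variable {N : ℕ}

/-- The matrix on the boson modes which acts as `f β • M` on the doublet `(b_β†, a_β†)`. The rows
and columns of `M` are labelled like those of `spinMat 1`: `0` is the down spin `b_β†` and `1` the
up spin `a_β†`. -/
def doubletMatrix (f : Fin N → ℂ) :
    Matrix (Fin 2) (Fin 2) ℂ →ₗ[ℂ] Matrix (Fin N ⊕ Fin N) (Fin N ⊕ Fin N) ℂ where
  toFun M := Matrix.fromBlocks (M 1 1 • Matrix.diagonal f) (M 1 0 • Matrix.diagonal f)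
    (M 0 1 • Matrix.diagonal f) (M 0 0 • Matrix.diagonal f)
  map_add' M L := by simp only [Matrix.fromBlocks_add, Matrix.add_apply, add_smul]
  map_smul' c M := by
    simp only [Matrix.fromBlocks_smul, Matrix.smul_apply, smul_assoc, RingHom.id_apply]

theorem doubletMatrix_mul (f g : Fin N → ℂ) (M L : Matrix (Fin 2) (Fin 2) ℂ) :
    doubletMatrix f M * doubletMatrix g L = doubletMatrix (f * g) (M * L) := by
  simp only [doubletMatrix, LinearMap.coe_mk, AddHom.coe_mk, Matrix.fromBlocks_multiply,
    smul_mul_smul_comm, Matrix.diagonal_mul_diagonal', ← add_smul, Matrix.mul_apply,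
    Fin.sum_univ_two]
  simp only [add_comm, Pi.mul_def]

/-- The second quantization of `M` on the Schwinger bosons with site weights `f`. -/
def bosonOp (f : Fin N → ℂ) : Matrix (Fin 2) (Fin 2) ℂ →ₗ[ℂ] Derivation ℂ (Fock N) (Fock N) :=
  secondQuant ∘ₗ doubletMatrix f

theorem bosonOp_apply (f : Fin N → ℂ) (M : Matrix (Fin 2) (Fin 2) ℂ) (P : Fock N) :
    bosonOp f M P = ∑ β, f β •
      (M 1 1 • (X (Sum.inl β) * pderiv (Sum.inl β) P)
        + M 1 0 • (X (Sum.inl β) * pderiv (Sum.inr β) P)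
        + M 0 1 • (X (Sum.inr β) * pderiv (Sum.inl β) P)
        + M 0 0 • (X (Sum.inr β) * pderiv (Sum.inr β) P)) := by
  simp only [bosonOp, doubletMatrix, LinearMap.comp_apply, LinearMap.coe_mk, AddHom.coe_mk,
    secondQuant_apply, Fintype.sum_sum_type, Matrix.fromBlocks_apply₁₁, Matrix.fromBlocks_apply₁₂,
    Matrix.fromBlocks_apply₂₁, Matrix.fromBlocks_apply₂₂, Matrix.smul_apply,
    Matrix.diagonal_apply, smul_assoc, ite_smul, zero_smul, smul_ite, smul_zero,
    Finset.sum_add_distrib, Finset.sum_ite_eq', Finset.mem_univ, if_true, smul_add]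
  simp only [← Finset.sum_add_distrib]
  exact Finset.sum_congr rfl fun β _ => by module

theorem bosonOp_inl (f : Fin N → ℂ) (M : Matrix (Fin 2) (Fin 2) ℂ) (α : Fin N) :
    bosonOp f M (X (Sum.inl α)) = f α • (M 1 1 • X (Sum.inl α) + M 0 1 • X (Sum.inr α)) := by
  simp [bosonOp_apply, pderiv_X, Pi.single_apply, Finset.sum_add_distrib]

theorem bosonOp_inr (f : Fin N → ℂ) (M : Matrix (Fin 2) (Fin 2) ℂ) (α : Fin N) :
    bosonOp f M (X (Sum.inr α)) = f α • (M 1 0 • X (Sum.inl α) + M 0 0 • X (Sum.inr α)) := by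
  simp [bosonOp_apply, pderiv_X, Pi.single_apply, Finset.sum_add_distrib]

theorem bosonOp_single_apply (α : Fin N) (M : Matrix (Fin 2) (Fin 2) ℂ) (P : Fock N) :
    bosonOp (Pi.single α 1) M P =
      M 1 1 • (X (Sum.inl α) * pderiv (Sum.inl α) P)
        + M 1 0 • (X (Sum.inl α) * pderiv (Sum.inr α) P)
        + M 0 1 • (X (Sum.inr α) * pderiv (Sum.inl α) P)
        + M 0 0 • (X (Sum.inr α) * pderiv (Sum.inr α) P) := by
  rw [bosonOp_apply, Finset.sum_eq_single α] <;> simp +contextual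

theorem bosonOp_eq_sum_single (f : Fin N → ℂ) (M : Matrix (Fin 2) (Fin 2) ℂ) (P : Fock N) :
    bosonOp f M P = ∑ β, f β • bosonOp (Pi.single β 1) M P := by
  simp only [bosonOp_single_apply, bosonOp_apply f]

theorem bosonOp_bosonOp (f g : Fin N → ℂ) (M L : Matrix (Fin 2) (Fin 2) ℂ) (P : Fock N) :
    bosonOp f M (bosonOp g L P) =
      bosonOp g L (bosonOp f M P) + bosonOp (f * g) (M * L - L * M) P := by
  simp only [bosonOp, LinearMap.comp_apply]
  rw [secondQuant_secondQuant, doubletMatrix_mul, doubletMatrix_mul, mul_comm g f, ← map_sub]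

theorem pderiv_inl_bosonOp (f : Fin N → ℂ) (M : Matrix (Fin 2) (Fin 2) ℂ) (α : Fin N)
    (P : Fock N) :
    pderiv (Sum.inl α) (bosonOp f M P) = bosonOp f M (pderiv (Sum.inl α) P)
      + f α • (M 1 1 • pderiv (Sum.inl α) P + M 1 0 • pderiv (Sum.inr α) P) := by
  simp only [bosonOp, doubletMatrix, LinearMap.comp_apply, LinearMap.coe_mk, AddHom.coe_mk,
    pderiv_secondQuant, Fintype.sum_sum_type, Matrix.fromBlocks_apply₁₁,
    Matrix.fromBlocks_apply₁₂, Matrix.smul_apply, Matrix.diagonal_apply, smul_assoc, ite_smul,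
    zero_smul, smul_ite, smul_zero, Finset.sum_ite_eq, Finset.mem_univ, if_true]
  module

theorem pderiv_inr_bosonOp (f : Fin N → ℂ) (M : Matrix (Fin 2) (Fin 2) ℂ) (α : Fin N)
    (P : Fock N) :
    pderiv (Sum.inr α) (bosonOp f M P) = bosonOp f M (pderiv (Sum.inr α) P)
      + f α • (M 0 1 • pderiv (Sum.inl α) P + M 0 0 • pderiv (Sum.inr α) P) := by
  simp only [bosonOp, doubletMatrix, LinearMap.comp_apply, LinearMap.coe_mk, AddHom.coe_mk,
    pderiv_secondQuant, Fintype.sum_sum_type, Matrix.fromBlocks_apply₂₁,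
    Matrix.fromBlocks_apply₂₂, Matrix.smul_apply, Matrix.diagonal_apply, smul_assoc, ite_smul,
    zero_smul, smul_ite, smul_zero, Finset.sum_ite_eq, Finset.mem_univ, if_true]
  module

/-- The number of bosons on the site `α`. -/
abbrev numberOp (α : Fin N) : Derivation ℂ (Fock N) (Fock N) := bosonOp (Pi.single α 1) 1

theorem numberOp_apply (α : Fin N) (P : Fock N) :
    numberOp α P = X (Sum.inl α) * pderiv (Sum.inl α) P + X (Sum.inr α) * pderiv (Sum.inr α) P := by
  simp [bosonOp_single_apply]

theorem numberOp_bosonOp (α : Fin N) (f : Fin N → ℂ) (M : Matrix (Fin 2) (Fin 2) ℂ) (P : Fock N) :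
    numberOp α (bosonOp f M P) = bosonOp f M (numberOp α P) := by
  simp [bosonOp_bosonOp _ f]

end SchwingerBosons

section FockSpin

open MvPolynomial

variable {N : ℕ} {α : Fin N} {P : Fock N}

theorem splusMat_one : splusMat 1 = !![0, 0; 1, 0] := by
  ext k l
  fin_cases k <;> fin_cases l <;> simp [splusMat]

theorem sminusMat_one : sminusMat 1 = !![0, 1; 0, 0] := by
  ext k l
  fin_cases k <;> fin_cases l <;> simp [sminusMat_apply, splusMat_one]

theorem szMat_one : szMat 1 = !![-(1 / 2), 0; 0, 1 / 2] := by
  ext k l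
  fin_cases k <;> fin_cases l <;> simp [szMat, spin]
  norm_num

/-- The raising operator `∑_β f_β a_β† b_β` on the Fock space. -/
abbrev fockRaise (f : Fin N → ℂ) : Derivation ℂ (Fock N) (Fock N) := bosonOp f (splusMat 1)

/-- The lowering operator `∑_β f_β b_β† a_β` on the Fock space. -/
abbrev fockLower (f : Fin N → ℂ) : Derivation ℂ (Fock N) (Fock N) := bosonOp f (sminusMat 1)

/-- The `z` component `½ ∑_β f_β (a_β† a_β - b_β† b_β)` of the spin on the Fock space. -/
abbrev fockSz (f : Fin N → ℂ) : Derivation ℂ (Fock N) (Fock N) := bosonOp f (szMat 1)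

theorem fockRaise_single_apply (α : Fin N) (P : Fock N) :
    fockRaise (Pi.single α 1) P = X (Sum.inl α) * pderiv (Sum.inr α) P := by
  simp [bosonOp_single_apply, splusMat_one]

theorem fockLower_single_apply (α : Fin N) (P : Fock N) :
    fockLower (Pi.single α 1) P = X (Sum.inr α) * pderiv (Sum.inl α) P := by
  simp [bosonOp_single_apply, sminusMat_one]

theorem fockSz_single_apply (α : Fin N) (P : Fock N) :
    fockSz (Pi.single α 1) P = (1 / 2 : ℂ) •
      (X (Sum.inl α) * pderiv (Sum.inl α) P - X (Sum.inr α) * pderiv (Sum.inr α) P) := by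
  simp only [bosonOp_single_apply, szMat_one, Matrix.of_apply, Matrix.cons_val]
  module

theorem fockRaise_fockLower (f g : Fin N → ℂ) (P : Fock N) :
    fockRaise f (fockLower g P) = fockLower g (fockRaise f P) + (2 : ℂ) • fockSz (f * g) P := by
  rw [bosonOp_bosonOp, splusMat_mul_sminusMat_sub, map_smul, Derivation.smul_apply]

theorem fockRaise_fockSz (f g : Fin N → ℂ) (P : Fock N) :
    fockRaise f (fockSz g P) = fockSz g (fockRaise f P) - fockRaise (f * g) P := by
  rw [bosonOp_bosonOp, ← neg_sub, szMat_mul_splusMat_sub, map_neg, Derivation.neg_apply,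
    sub_eq_add_neg]

theorem pderiv_inl_fockRaise (f : Fin N → ℂ) (P : Fock N) :
    pderiv (Sum.inl α) (fockRaise f P) =
      fockRaise f (pderiv (Sum.inl α) P) + f α • pderiv (Sum.inr α) P := by
  rw [pderiv_inl_bosonOp]
  congr 2
  simp [splusMat_one]

theorem pderiv_inr_fockRaise (f : Fin N → ℂ) (P : Fock N) :
    pderiv (Sum.inr α) (fockRaise f P) = fockRaise f (pderiv (Sum.inr α) P) := by
  rw [pderiv_inr_bosonOp, add_eq_left]
  simp [splusMat_one]

theorem fockRaise_inl (f : Fin N → ℂ) (α : Fin N) : fockRaise f (X (Sum.inl α)) = 0 := by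
  simp [bosonOp_inl, splusMat_one]

theorem fockRaise_inr (f : Fin N → ℂ) (α : Fin N) :
    fockRaise f (X (Sum.inr α)) = f α • X (Sum.inl α) := by
  simp [bosonOp_inr, splusMat_one]

/-! ### Highest weight vectors -/

theorem eq_zero_of_numberOp_eq_neg_self (h : numberOp α P = -P) : P = 0 := by
  ext m
  have hm := congrArg (coeff m) h
  rw [numberOp_apply, coeff_add, coeff_X_mul_pderiv, coeff_X_mul_pderiv, coeff_neg] at hm
  have : ((m (Sum.inl α) + m (Sum.inr α) + 1 : ℕ) : ℂ) * coeff m P = 0 := by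
    push_cast
    linear_combination hm
  exact (mul_eq_zero.1 this).resolve_left (Nat.cast_ne_zero.2 (Nat.succ_ne_zero _))

theorem numberOp_pderiv_inl {c : ℂ} (h : numberOp α P = c • P) :
    numberOp α (pderiv (Sum.inl α) P) = (c - 1) • pderiv (Sum.inl α) P := by
  have := congrArg (pderiv (Sum.inl α)) h
  rw [pderiv_inl_bosonOp, Derivation.map_smul] at this
  simp only [Pi.single_eq_same, Matrix.one_apply, if_true, one_smul, one_ne_zero, if_false,
    zero_smul, add_zero] at this
  rw [sub_smul, one_smul, ← this, add_sub_cancel_right]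

theorem numberOp_pderiv_inr {c : ℂ} (h : numberOp α P = c • P) :
    numberOp α (pderiv (Sum.inr α) P) = (c - 1) • pderiv (Sum.inr α) P := by
  have := congrArg (pderiv (Sum.inr α)) h
  rw [pderiv_inr_bosonOp, Derivation.map_smul] at this
  simp only [Pi.single_eq_same, Matrix.one_apply, if_true, one_smul, zero_ne_one, if_false,
    zero_smul, zero_add] at this
  rw [sub_smul, one_smul, ← this, add_sub_cancel_right]

theorem pderiv_inl_pderiv_inl_eq_zero (h : numberOp α P = P) :
    pderiv (Sum.inl α) (pderiv (Sum.inl α) P) = 0 := by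
  have h₁ : numberOp α P = (1 : ℂ) • P := by rw [h, one_smul]
  refine eq_zero_of_numberOp_eq_neg_self (α := α) ?_
  rw [numberOp_pderiv_inl (numberOp_pderiv_inl h₁)]
  module

theorem iterate_pderiv_inl_fockRaise (k : ℕ) (P : Fock N) :
    (pderiv (Sum.inl α))^[k + 1] (fockRaise 1 P) =
      fockRaise 1 ((pderiv (Sum.inl α))^[k + 1] P)
        + ((k : ℂ) + 1) • pderiv (Sum.inr α) ((pderiv (Sum.inl α))^[k] P) := by
  induction k generalizing P with
  | zero => simp [pderiv_inl_fockRaise]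
  | succ k ih =>
    rw [Function.iterate_succ_apply', ih, map_add, pderiv_inl_fockRaise, Derivation.map_smul,
      pderiv_pderiv_comm]
    simp only [Function.iterate_succ_apply', Pi.one_apply, Nat.cast_succ]
    module

/-- The raising operator moves every component of `P` towards the one with all the bosons on the
site `α` of type `a`. -/
theorem eq_zero_of_fockRaise_eq_zero {k : ℕ} (hnum : numberOp α P = (k : ℂ) • P)
    (hraise : fockRaise 1 P = 0) (htop : (pderiv (Sum.inl α))^[k] P = 0) : P = 0 := by
  induction k generalizing P with
  | zero => exact htop
  | succ k ih =>
    have cast_sub : ((k + 1 : ℕ) : ℂ) - 1 = k := by push_cast; ring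
    have hb : pderiv (Sum.inr α) P = 0 := by
      refine ih (by rw [numberOp_pderiv_inr hnum, cast_sub]) ?_ ?_
      · rw [← pderiv_inr_fockRaise, hraise, map_zero]
      · have h := iterate_pderiv_inl_fockRaise (α := α) k P
        rw [hraise, htop, map_zero, zero_add, iterate_map_zero] at h
        have hcomm := Function.Commute.iterate_left
          (f := pderiv (R := ℂ) (Sum.inl α)) (g := pderiv (R := ℂ) (Sum.inr α))
          (fun Q => pderiv_pderiv_comm _ _ Q) k
        rw [hcomm P]
        exact (smul_eq_zero.1 h.symm).resolve_left (Nat.cast_add_one_ne_zero k)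
    have ha : pderiv (Sum.inl α) P = 0 := by
      refine ih (by rw [numberOp_pderiv_inl hnum, cast_sub]) ?_ htop
      have h := pderiv_inl_fockRaise (α := α) 1 P
      rwa [hraise, map_zero, hb, smul_zero, add_zero, eq_comm] at h
    rw [numberOp_apply, ha, hb, mul_zero, mul_zero, zero_add, eq_comm] at hnum
    exact (smul_eq_zero.1 hnum).resolve_left (Nat.cast_ne_zero.2 k.succ_ne_zero)

end FockSpin

/-! ### The contraction of the spin on the Fock space with the triplet of a site -/

section Contraction

open MvPolynomial

variable {N : ℕ} {α : Fin N} {f : Fin N → ℂ} {P : Fock N}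

/-- The components of `∑_β f_β 𝐒_β` on the Fock space. -/
def fockSpin (f : Fin N → ℂ) : Fin 3 → Module.End ℂ (Fock N) :=
  ofLadder (fockRaise f).toLinearMap (fockLower f).toLinearMap (fockSz f).toLinearMap

theorem ofLadder_apply {V : Type*} [AddCommGroup V] [Module ℂ V] (p m z : Module.End ℂ V) (v : V)
    (i : Fin 3) : ofLadder p m z i v = ofLadder (p v) (m v) (z v) i :=
  map_ofLadder (LinearMap.applyₗ v) p m z i

theorem smul_ofLadder_apply {V : Type*} [AddCommGroup V] [Module ℂ V] (c : ℂ) (p m z : V)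
    (i : Fin 3) : c • ofLadder p m z i = ofLadder (c • p) (c • m) (c • z) i :=
  map_ofLadder (LinearMap.lsmul ℂ V c) p m z i

/-- The singlet which arises from the vector operator `∑_β f_β 𝐒_β` and the triplet
`(a_α†)², a_α† b_α†, (b_α†)²`. It contains the same information as the projection of the vector
operator to the spin `s + 1` at the site `α`, see `topSpinMatrix_fockSpin_mulVec_apply`. -/
def tripletContraction (α : Fin N) (f : Fin N → ℂ) : Derivation ℂ (Fock N) (Fock N) :=
  (X (Sum.inl α) ^ 2 : Fock N) • fockLower f - (X (Sum.inr α) ^ 2 : Fock N) • fockRaise f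
    - (2 * X (Sum.inl α) * X (Sum.inr α) : Fock N) • fockSz f

theorem tripletContraction_apply (α : Fin N) (f : Fin N → ℂ) (P : Fock N) :
    tripletContraction α f P = X (Sum.inl α) ^ 2 * fockLower f P
      - X (Sum.inr α) ^ 2 * fockRaise f P - 2 * X (Sum.inl α) * X (Sum.inr α) * fockSz f P :=
  rfl

theorem fockRaise_tripletContraction (α : Fin N) (f : Fin N → ℂ) (P : Fock N) :
    fockRaise 1 (tripletContraction α f P) = tripletContraction α f (fockRaise 1 P) := by
  have h2 : fockRaise 1 (2 : Fock N) = 0 := Derivation.map_natCast _ 2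
  have hFF : fockRaise 1 (fockRaise f P) = fockRaise f (fockRaise 1 P) := by
    rw [bosonOp_bosonOp, sub_self, map_zero, Derivation.zero_apply, add_zero]
  simp only [tripletContraction_apply, map_sub, Derivation.leibniz, Derivation.leibniz_pow,
    fockRaise_inl, fockRaise_inr, fockRaise_fockLower, fockRaise_fockSz, hFF, h2, one_mul,
    Pi.one_apply, smul_eq_mul, Algebra.smul_def, map_ofNat, map_one]
  ring

theorem numberOp_tripletContraction (f : Fin N → ℂ) {c : ℂ} (h : numberOp α P = c • P) :
    numberOp α (tripletContraction α f P) = (c + 2) • tripletContraction α f P := by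
  have h2 : numberOp α (2 : Fock N) = 0 := Derivation.map_natCast _ 2
  have ha : numberOp α (X (Sum.inl α)) = X (Sum.inl α) := by simp [numberOp_apply]
  have hb : numberOp α (X (Sum.inr α)) = X (Sum.inr α) := by simp [numberOp_apply]
  have hF (M : Matrix (Fin 2) (Fin 2) ℂ) :
      numberOp α (bosonOp f M P) = MvPolynomial.C c * bosonOp f M P := by
    rw [numberOp_bosonOp, h, Derivation.map_smul, smul_eq_C_mul]
  simp only [tripletContraction_apply, map_sub, Derivation.leibniz, Derivation.leibniz_pow,
    hF, ha, hb, h2, smul_eq_mul, smul_eq_C_mul, map_add, map_ofNat]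
  ring

theorem iterate_pderiv_inl_tripletContraction (hf : f α = 0) (hP : numberOp α P = P) :
    (pderiv (Sum.inl α))^[3] (tripletContraction α f P) =
      6 * fockLower f (pderiv (Sum.inl α) P) := by
  have hcomm (M : Matrix (Fin 2) (Fin 2) ℂ) (Q : Fock N) :
      pderiv (Sum.inl α) (bosonOp f M Q) = bosonOp f M (pderiv (Sum.inl α) Q) := by
    rw [pderiv_inl_bosonOp, hf, zero_smul, add_zero]
  have h2 : pderiv (Sum.inl α) (2 : Fock N) = 0 := Derivation.map_natCast _ 2
  have ha : pderiv (Sum.inl α) (X (Sum.inl α) : Fock N) = 1 := pderiv_X_self _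
  have hb : pderiv (Sum.inl α) (X (Sum.inr α) : Fock N) = 0 := pderiv_X_of_ne (by simp)
  simp only [Function.iterate_succ_apply', Function.iterate_zero_apply, tripletContraction_apply,
    sq, map_sub, map_add, Derivation.leibniz, hcomm, ha, hb, h2, pderiv_inl_pderiv_inl_eq_zero hP,
    map_zero, smul_eq_mul, mul_zero, mul_one, add_zero, zero_add,
    Derivation.map_one_eq_zero]
  ring

theorem tripletContraction_eq_zero (hf : f α = 0) (hP : numberOp α P = P)
    (hraise : fockRaise 1 P = 0) (hlower : fockLower f (pderiv (Sum.inl α) P) = 0) :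
    tripletContraction α f P = 0 := by
  refine eq_zero_of_fockRaise_eq_zero (α := α) (k := 3) ?_ ?_ ?_
  · rw [numberOp_tripletContraction f (c := 1) (by rw [hP, one_smul])]
    norm_num
  · rw [fockRaise_tripletContraction, hraise, map_zero]
  · rw [iterate_pderiv_inl_tripletContraction hf hP, hlower, mul_zero]

/-- On polynomials of degree `n = 2s` in `a`, `b` the ladder operators of spin `s` are `a ∂_b` and
`b ∂_a`, and the projection to the spin `s + 1` of a triple of such polynomials is determined by
their contraction `W` with the triplet `a²`, `a b`, `b²`. -/
theorem top_spin_projection {A : Type*} [CommRing A] [Algebra ℂ A] (da db : Derivation ℂ A A)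
    {a b p m z D W : A} {n : ℂ} (haa : da a = 1) (hab : da b = 0) (hba : db a = 0) (hbb : db b = 1)
    (hcomm : ∀ x, db (da x) = da (db x)) (hp : a * da p + b * db p = n • p)
    (hm : a * da m + b * db m = n • m) (hz : a * da z + b * db z = n • z)
    (hD : D = a * db m + b * da p + (a * da z - b * db z))
    (hW : W = a ^ 2 * m - b ^ 2 * p - 2 * a * b * z) :
    (2 * (n + 2)) • (a * db z) - (n + 2) • (a * da p - b * db p) + ((n + 2) ^ 2) • p
        - (2 : ℂ) • (a * db D) = -(2 : ℂ) • db (db W) ∧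
      (n + 2) • (a * da m - b * db m) - (2 * (n + 2)) • (b * da z) + ((n + 2) ^ 2) • m
        - (2 : ℂ) • (b * da D) = (2 : ℂ) • da (da W) ∧
      (n + 2) • (b * da p - a * db m) + ((n + 2) ^ 2) • z - (a * da D - b * db D) =
        -(2 : ℂ) • da (db W) := by
  have h2a : da (2 : A) = 0 := Derivation.map_natCast da 2
  have h2b : db (2 : A) = 0 := Derivation.map_natCast db 2
  have hpa := congrArg da hp
  have hpb := congrArg db hp
  have hma := congrArg da hm
  have hmb := congrArg db hm
  have hza := congrArg da hz
  have hzb := congrArg db hz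
  subst hD hW
  simp only [map_add, map_sub, Derivation.leibniz, Derivation.leibniz_pow, Derivation.map_smul,
    haa, hab, hba, hbb, hcomm, h2a, h2b, smul_eq_mul, nsmul_eq_mul, Nat.cast_ofNat, mul_zero,
    mul_one, add_zero, zero_add] at hpa hpb hma hmb hza hzb ⊢
  simp only [Algebra.smul_def, map_add, map_mul, map_pow, map_neg, map_ofNat] at *
  refine ⟨?_, ?_, ?_⟩
  · linear_combination -(algebraMap ℂ A n + 4) * hp - 2 * b * hpb - 2 * a * hzb
  · linear_combination -(algebraMap ℂ A n + 4) * hm - 2 * a * hma + 2 * b * hza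
  · linear_combination -b * hpa + a * hmb - a * hza - b * hzb - (algebraMap ℂ A n + 4) * hz

theorem topSpinMatrix_fockSpin_mulVec_apply {n : ℕ} (f : Fin N → ℂ)
    (hP : numberOp α P = (n : ℂ) • P) (i : Fin 3) :
    (topSpinMatrix (spin n) (fockSpin (Pi.single α 1)) *ᵥ fockSpin f) i P =
      ((n : ℂ) + 2)⁻¹ • ofLadder
        (-pderiv (Sum.inr α) (pderiv (Sum.inr α) (tripletContraction α f P)))
        (pderiv (Sum.inl α) (pderiv (Sum.inl α) (tripletContraction α f P)))
        (-pderiv (Sum.inl α) (pderiv (Sum.inr α) (tripletContraction α f P))) i := by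
  have hnum (M : Matrix (Fin 2) (Fin 2) ℂ) :
      X (Sum.inl α) * pderiv (Sum.inl α) (bosonOp f M P)
        + X (Sum.inr α) * pderiv (Sum.inr α) (bosonOp f M P) = (n : ℂ) • bosonOp f M P := by
    rw [← numberOp_apply, numberOp_bosonOp, hP, Derivation.map_smul]
  obtain ⟨hp, hm, hz⟩ := top_spin_projection (pderiv (Sum.inl α)) (pderiv (Sum.inr α))
    (pderiv_X_self _) (pderiv_X_of_ne (by simp)) (pderiv_X_of_ne (by simp)) (pderiv_X_self _)
    (fun _ => pderiv_pderiv_comm _ _ _) (hnum (splusMat 1)) (hnum (sminusMat 1)) (hnum (szMat 1))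
    rfl (tripletContraction_apply α f P)
  have hn : (n : ℂ) + 2 ≠ 0 := by exact_mod_cast (by omega : n + 2 ≠ 0)
  have hs : (spin n : ℂ) + 1 = ((n : ℂ) + 2) / 2 := by
    rw [spin]
    push_cast
    ring
  rw [fockSpin, fockSpin, topSpinMatrix_ofLadder_mulVec, ofLadder_apply, hs,
    smul_ofLadder_apply]
  simp only [Module.End.mul_apply, LinearMap.add_apply, LinearMap.sub_apply, LinearMap.smul_apply,
    Derivation.coeFn_coe, fockRaise_single_apply, fockLower_single_apply, fockSz_single_apply,
    ← smul_add, Derivation.map_smul]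
  refine congrFun (congr (congrArg₂ ofLadder ?_ ?_) ?_) i
  · linear_combination (norm := skip) (1 / (2 * ((n : ℂ) + 2))) • hp
    match_scalars <;> field_simp <;> ring
  · linear_combination (norm := skip) (1 / (2 * ((n : ℂ) + 2))) • hm
    match_scalars <;> field_simp <;> ring
  · linear_combination (norm := skip) (1 / (2 * ((n : ℂ) + 2))) • hz
    match_scalars <;> field_simp <;> ring

end Contraction

/-! ### The Haldane–Shastry polynomial -/

section HaldaneShastryPolynomial

open MvPolynomial

variable {N : ℕ}

/-- The state of the chain of spins one half in which the up spins occupy the set `Z` of sites. -/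
def configPoly (Z : Finset (Fin N)) : Fock N :=
  ∏ α, X (if α ∈ Z then Sum.inl α else Sum.inr α)

theorem hsPoly_eq (N : ℕ) : hsPoly N =
    ∑ Z ∈ (Finset.univ : Finset (Fin N)).powersetCard (N / 2), hsAmplitude N Z • configPoly Z := by
  refine Finset.sum_congr rfl fun Z _ => ?_
  rw [smul_eq_C_mul, configPoly, ← Finset.prod_mul_prod_compl Z]
  congr 2
  · exact Finset.prod_congr rfl fun α hα => by rw [if_pos hα]
  · exact Finset.prod_congr rfl fun α hα => by rw [if_neg (Finset.mem_compl.1 hα)]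

theorem bosonOp_diagonal_configPoly (f : Fin N → ℂ) (d : Fin 2 → ℂ) (Z : Finset (Fin N)) :
    bosonOp f (Matrix.diagonal d) (configPoly Z) =
      (∑ α, f α * if α ∈ Z then d 1 else d 0) • configPoly Z := by
  rw [configPoly, derivation_prod, Finset.sum_smul]
  refine Finset.sum_congr rfl fun α _ => ?_
  rw [← Finset.prod_erase_mul _ _ (Finset.mem_univ α), ← mul_smul_comm]
  congr 1
  split_ifs <;> simp [bosonOp_inl, bosonOp_inr, mul_smul]

theorem fockLower_configPoly (f : Fin N → ℂ) (Z : Finset (Fin N)) :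
    fockLower f (configPoly Z) = ∑ β ∈ Z, f β • configPoly (Z.erase β) := by
  rw [configPoly, derivation_prod, ← Finset.univ_inter Z, ← Finset.sum_ite_mem, Finset.univ_inter]
  refine Finset.sum_congr rfl fun β _ => ?_
  split_ifs with hβ
  · have hprod : ∏ γ ∈ Finset.univ.erase β,
        (X (if γ ∈ Z.erase β then Sum.inl γ else Sum.inr γ) : Fock N) =
          ∏ γ ∈ Finset.univ.erase β, X (if γ ∈ Z then Sum.inl γ else Sum.inr γ) :=
      Finset.prod_congr rfl fun γ hγ => by simp [Finset.ne_of_mem_erase hγ]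
    rw [configPoly, ← Finset.prod_erase_mul _ _ (Finset.mem_univ β), hprod,
      if_neg (Finset.notMem_erase β Z), bosonOp_inl, sminusMat_one]
    simp
  · rw [bosonOp_inr, sminusMat_one]
    simp

theorem pderiv_inl_configPoly {α : Fin N} {Z : Finset (Fin N)} (h : α ∉ Z) :
    pderiv (Sum.inl α) (configPoly Z) = 0 := by
  rw [configPoly, derivation_prod]
  refine Finset.sum_eq_zero fun β _ => ?_
  rw [pderiv_X_of_ne, mul_zero]
  split_ifs with hβ
  · exact fun hβα => h (Sum.inl_injective hβα ▸ hβ)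
  · exact Sum.inr_ne_inl

theorem fockLower_sum_smul_configPoly (f : Fin N → ℂ) (c : Finset (Fin N) → ℂ) (k : ℕ) :
    fockLower f (∑ Z ∈ Finset.univ.powersetCard (k + 1), c Z • configPoly Z) =
      ∑ Y ∈ Finset.univ.powersetCard k, (∑ β ∈ Yᶜ, f β * c (insert β Y)) • configPoly Y := by
  simp only [map_sum, Derivation.map_smul, fockLower_configPoly, Finset.smul_sum, Finset.sum_smul]
  rw [Finset.sum_sigma', Finset.sum_sigma']
  refine Finset.sum_bij' (fun x _ => ⟨x.1.erase x.2, x.2⟩) (fun x _ => ⟨insert x.2 x.1, x.2⟩)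
    ?_ ?_ ?_ ?_ ?_ <;>
  rintro ⟨Z, β⟩ hx <;>
  simp only [Finset.mem_sigma, Finset.mem_powersetCard_univ, Finset.mem_compl] at hx ⊢
  · exact ⟨by rw [Finset.card_erase_of_mem hx.2, hx.1, Nat.add_sub_cancel], Finset.notMem_erase β Z⟩
  · exact ⟨by rw [Finset.card_insert_of_notMem hx.2, hx.1], Finset.mem_insert_self β Z⟩
  · rw [Finset.insert_erase hx.2]
  · rw [Finset.erase_insert hx.2]
  · rw [Finset.insert_erase hx.2, smul_smul, mul_comm]

theorem hsAmplitude_insert {β : Fin N} {Y : Finset (Fin N)} (h : β ∉ Y) :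
    hsAmplitude N (insert β Y) =
      hsAmplitude N Y * (site N β * ∏ γ ∈ Y, (site N β - site N γ) ^ 2) := by
  have split_prod : ∏ γ ∈ Y, (site N β - site N γ) ^ 2 =
      (∏ γ ∈ Y, if β < γ then (site N β - site N γ) ^ 2 else 1) *
        ∏ γ ∈ Y, if γ < β then (site N γ - site N β) ^ 2 else 1 := by
    rw [← Finset.prod_mul_distrib]
    refine Finset.prod_congr rfl fun γ hγ => ?_
    rcases lt_trichotomy β γ with hlt | heq | hgt
    · simp [hlt, hlt.not_gt]
    · exact absurd (heq ▸ hγ) h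
    · rw [if_neg hgt.not_gt, if_pos hgt]
      ring
  rw [hsAmplitude, hsAmplitude, split_prod, Finset.prod_filter, Finset.prod_filter,
    Finset.prod_product, Finset.prod_product, Finset.prod_insert h, Finset.prod_insert h,
    Finset.prod_insert h]
  simp only [lt_self_iff_false, if_false, Finset.prod_insert h, Finset.prod_mul_distrib]
  ring

theorem hsAmplitude_ne_zero (Z : Finset (Fin N)) : hsAmplitude N Z ≠ 0 := by
  induction Z using Finset.induction_on with
  | empty => simp [hsAmplitude]
  | insert β Y h ih =>
    rw [hsAmplitude_insert h]
    refine mul_ne_zero ih (mul_ne_zero (site_ne_zero β) (Finset.prod_ne_zero_iff.2 fun γ hγ => ?_))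
    exact pow_ne_zero _ (sub_ne_zero.2 (site_injective.ne fun hβγ => h (hβγ ▸ hγ)))

theorem fockLower_hsPoly (hN : 1 ≤ N / 2) (f : Fin N → ℂ) : fockLower f (hsPoly N) =
    ∑ Y ∈ (Finset.univ : Finset (Fin N)).powersetCard (N / 2 - 1),
      (hsAmplitude N Y * ∑ β, f β * (site N β * ∏ γ ∈ Y, (site N β - site N γ) ^ 2)) •
        configPoly Y := by
  rw [hsPoly_eq, ← Nat.sub_add_cancel hN, fockLower_sum_smul_configPoly, Nat.add_sub_cancel]
  refine Finset.sum_congr rfl fun Y _ => ?_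
  rw [← Finset.sum_subset (Finset.subset_univ Yᶜ), Finset.mul_sum]
  · congr 1
    refine Finset.sum_congr rfl fun β hβ => ?_
    rw [hsAmplitude_insert (Finset.mem_compl.1 hβ)]
    ring
  · intro β _ hβ
    rw [Finset.prod_eq_zero (i := β) (by simpa using hβ) (by simp), mul_zero, mul_zero]

open Polynomial in
theorem sum_site_mul_eval_mul_prod_sq (Q : ℂ[X]) (Y : Finset (Fin N))
    (h : Q.natDegree + 2 * Y.card + 1 < N) :
    ∑ β, site N β * (Q.eval (site N β) * ∏ γ ∈ Y, (site N β - site N γ) ^ 2) = 0 := by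
  have hdeg : (∏ γ ∈ Y, (Polynomial.X - Polynomial.C (site N γ)) ^ 2).natDegree = 2 * Y.card := by
    rw [natDegree_prod_of_monic _ _ fun γ _ => (monic_X_sub_C _).pow 2]
    simp [mul_comm]
  have hle : (Polynomial.X *
      (Q * ∏ γ ∈ Y, (Polynomial.X - Polynomial.C (site N γ)) ^ 2)).natDegree < N := by
    refine (natDegree_mul_le.trans (add_le_add_right natDegree_mul_le _)).trans_lt ?_
    rw [natDegree_X, hdeg]
    omega
  simpa [Polynomial.eval_prod] using sum_eval_site hle

theorem fockLower_one_hsPoly (hN : N ≠ 0) (he : Even N) : fockLower 1 (hsPoly N) = 0 := by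
  obtain ⟨M, hM⟩ := he
  rw [fockLower_hsPoly (by omega)]
  refine Finset.sum_eq_zero fun Y hY => ?_
  rw [Finset.mem_powersetCard_univ] at hY
  have h := sum_site_mul_eval_mul_prod_sq 1 Y (by rw [Polynomial.natDegree_one]; omega)
  simp only [Polynomial.eval_one, one_mul] at h
  simp [h]

theorem sum_siteTheta_mul_prod_sq {α : Fin N} {Y : Finset (Fin N)} (hα : α ∈ Y)
    (hY : 2 * Y.card + 1 < N) :
    ∑ β, siteTheta N α β * (site N β * ∏ γ ∈ Y, (site N β - site N γ) ^ 2) = 0 := by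
  have cancel (β : Fin N) : siteTheta N α β * (site N β - site N α) ^ 2 =
      -((site N β + site N α) * (site N β - site N α)) := by
    rcases eq_or_ne α β with rfl | hβ
    · simp
    · have := sub_ne_zero.2 (site_injective.ne hβ)
      rw [siteTheta, theta]
      field_simp
      ring
  have hdeg : ((Polynomial.X + Polynomial.C (site N α)) *
      (Polynomial.X - Polynomial.C (site N α))).natDegree ≤ 2 := by
    refine Polynomial.natDegree_mul_le.trans ?_
    rw [Polynomial.natDegree_X_add_C, Polynomial.natDegree_X_sub_C]
  have hcard := Finset.card_erase_add_one hα
  rw [← neg_eq_zero, ← Finset.sum_neg_distrib, ← sum_site_mul_eval_mul_prod_sq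
    ((Polynomial.X + Polynomial.C (site N α)) * (Polynomial.X - Polynomial.C (site N α)))
    (Y.erase α) (by omega)]
  refine Finset.sum_congr rfl fun β _ => ?_
  simp only [Polynomial.eval_mul, Polynomial.eval_add, Polynomial.eval_sub, Polynomial.eval_X,
    Polynomial.eval_C]
  rw [← Finset.mul_prod_erase _ _ hα]
  linear_combination (-site N β * ∏ γ ∈ Y.erase α, (site N β - site N γ) ^ 2) * cancel β

theorem fockLower_siteTheta_pderiv_hsPoly (he : Even N) (α : Fin N) :
    fockLower (siteTheta N α) (pderiv (Sum.inl α) (hsPoly N)) = 0 := by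
  obtain ⟨M, hM⟩ := he
  have hN := α.pos
  have hcomm := pderiv_inl_bosonOp (siteTheta N α) (sminusMat 1) α (hsPoly N)
  rw [siteTheta_self, zero_smul, add_zero] at hcomm
  rw [← hcomm, fockLower_hsPoly (by omega), map_sum]
  refine Finset.sum_eq_zero fun Y hY => ?_
  rw [Finset.mem_powersetCard_univ] at hY
  by_cases hα : α ∈ Y
  · rw [sum_siteTheta_mul_prod_sq hα (by omega), mul_zero, zero_smul, map_zero]
  · rw [Derivation.map_smul, pderiv_inl_configPoly hα, smul_zero]

theorem fockSz_one_hsPoly (he : Even N) : fockSz 1 (hsPoly N) = 0 := by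
  obtain ⟨M, hM⟩ := he
  rw [hsPoly_eq, map_sum]
  refine Finset.sum_eq_zero fun Z hZ => ?_
  have hcard : Zᶜ.card = Z.card := by
    rw [Finset.card_compl, Fintype.card_fin, Finset.mem_powersetCard_univ.1 hZ]
    omega
  have diagonal : szMat 1 = Matrix.diagonal ![-(1 / 2), 1 / 2] := by
    rw [szMat_one, Matrix.diagonal_vec2]
  have balance : ∑ α, (1 : Fin N → ℂ) α * (if α ∈ Z then (1 / 2 : ℂ) else -(1 / 2)) = 0 := by
    simp [Finset.sum_ite, ← Finset.compl_filter, hcard]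
  rw [Derivation.map_smul, fockSz, diagonal, bosonOp_diagonal_configPoly, Matrix.cons_val_zero,
    Matrix.cons_val_one, Matrix.cons_val_zero, balance, zero_smul, smul_zero]

theorem numberOp_hsPoly (α : Fin N) : numberOp α (hsPoly N) = hsPoly N := by
  simp only [numberOp, hsPoly_eq, map_sum, Derivation.map_smul, ← Matrix.diagonal_one,
    bosonOp_diagonal_configPoly]
  simp

theorem eval_configPoly (Z Z₀ : Finset (Fin N)) :
    eval (Sum.elim (fun α => if α ∈ Z₀ then (1 : ℂ) else 0) fun α => if α ∈ Z₀ then 0 else 1)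
      (configPoly Z) = if Z = Z₀ then 1 else 0 := by
  have factor (α : Fin N) : eval (Sum.elim (fun α => if α ∈ Z₀ then (1 : ℂ) else 0)
      fun α => if α ∈ Z₀ then 0 else 1) (X (if α ∈ Z then Sum.inl α else Sum.inr α)) =
        if (α ∈ Z ↔ α ∈ Z₀) then 1 else 0 := by
    by_cases hα : α ∈ Z <;> simp [hα]
  simp only [configPoly, map_prod, factor, Finset.ext_iff]
  split_ifs with h
  · exact Finset.prod_eq_one fun α _ => if_pos (h α)
  · obtain ⟨α, hα⟩ := not_forall.1 h
    exact Finset.prod_eq_zero (Finset.mem_univ α) (if_neg hα)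

theorem hsPoly_ne_zero (N : ℕ) : hsPoly N ≠ 0 := by
  obtain ⟨Z₀, -, hZ₀⟩ := Finset.exists_subset_card_eq
    (s := (Finset.univ : Finset (Fin N))) (n := N / 2) (by rw [Finset.card_fin]; omega)
  intro h
  have heval := congrArg (eval (Sum.elim (fun α => if α ∈ Z₀ then (1 : ℂ) else 0)
    fun α => if α ∈ Z₀ then 0 else 1)) h
  simp only [hsPoly_eq, map_sum, smul_eval, eval_configPoly, mul_ite, mul_one, mul_zero,
    Finset.sum_ite_eq', Finset.mem_powersetCard_univ, hZ₀, if_true, map_zero] at heval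
  exact hsAmplitude_ne_zero Z₀ heval

end HaldaneShastryPolynomial

/-! ### From the Fock space to the spin chain -/

section FockToState

open MvPolynomial

variable {N n : ℕ}

/-- `fockToState` as a linear map. -/
def fockToStateLin (N n : ℕ) : Fock N →ₗ[ℂ] State N n where
  toFun := fockToState N n
  map_add' P Q := by
    ext σ
    simp [fockToState, add_mul]
  map_smul' c P := by
    ext σ
    simp [fockToState, mul_assoc]

theorem psi0_eq (N n : ℕ) : psi0 N n = fockToStateLin N n (hsPoly N ^ n) := rfl

/-- The norm `√(k! (n - k)!)` of the state with `k` bosons of type `a` and `n - k` bosons of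
type `b` on a site. -/
def bosonNorm (n k : ℕ) : ℝ := √((k.factorial : ℝ) * ((n - k).factorial : ℝ))

theorem bosonNorm_ne_zero (n k : ℕ) : bosonNorm n k ≠ 0 :=
  (Real.sqrt_pos.2 (by positivity)).ne'

theorem fockToStateLin_apply (P : Fock N) (σ : Config N n) :
    fockToStateLin N n P σ = coeff (occupation σ) P * ∏ α, (bosonNorm n (σ α) : ℂ) := by
  rw [← Complex.ofReal_prod]
  rfl

theorem bosonNorm_eq_sqrt_sub_mul {k : ℕ} (h : k + 1 ≤ n) :
    bosonNorm n k = √((n : ℝ) - k) * √((k.factorial : ℝ) * ((n - (k + 1)).factorial : ℝ)) := by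
  have hsub : ((n - (k + 1) : ℕ) : ℝ) + 1 = n - k := by rw [Nat.cast_sub h]; push_cast; ring
  rw [bosonNorm, (by omega : n - k = n - (k + 1) + 1), Nat.factorial_succ, ← hsub,
    ← Real.sqrt_mul (by positivity)]
  push_cast
  ring_nf

theorem bosonNorm_succ (n k : ℕ) :
    bosonNorm n (k + 1) =
      √((k : ℝ) + 1) * √((k.factorial : ℝ) * ((n - (k + 1)).factorial : ℝ)) := by
  rw [bosonNorm, Nat.factorial_succ, ← Real.sqrt_mul (by positivity)]
  push_cast
  ring_nf

theorem splusMat_mul_bosonNorm (k l : Fin (n + 1)) :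
    splusMat n k l * bosonNorm n l =
      if (k : ℕ) = l + 1 then ((n - l : ℕ) : ℂ) * bosonNorm n k else 0 := by
  rw [splusMat, Matrix.of_apply]
  split_ifs with h
  · have hl : (l : ℕ) + 1 ≤ n := by omega
    have hnonneg : (0 : ℝ) ≤ (n : ℝ) - (l : ℕ) := sub_nonneg.2 (by exact_mod_cast l.is_le)
    rw [h, bosonNorm_eq_sqrt_sub_mul hl, bosonNorm_succ, Real.sqrt_mul hnonneg,
      ← Complex.ofReal_natCast, Nat.cast_sub l.is_le, ← Complex.ofReal_mul, ← Complex.ofReal_mul]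
    congr 1
    linear_combination √((l : ℝ) + 1) * √(((l : ℕ).factorial : ℝ) * ((n - (l + 1)).factorial : ℝ))
      * Real.mul_self_sqrt hnonneg
  · exact zero_mul _

theorem sminusMat_mul_bosonNorm (k l : Fin (n + 1)) :
    sminusMat n k l * bosonNorm n l =
      if (l : ℕ) = k + 1 then ((l : ℕ) : ℂ) * bosonNorm n k else 0 := by
  rw [sminusMat_apply, splusMat, Matrix.of_apply]
  split_ifs with h
  · have hk : (k : ℕ) + 1 ≤ n := by omega
    have hnonneg : (0 : ℝ) ≤ (n : ℝ) - (k : ℕ) := sub_nonneg.2 (by exact_mod_cast k.is_le)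
    rw [h, bosonNorm_eq_sqrt_sub_mul hk, bosonNorm_succ, Real.sqrt_mul hnonneg,
      ← Complex.ofReal_natCast, ← Complex.ofReal_mul, ← Complex.ofReal_mul, Nat.cast_succ]
    congr 1
    linear_combination √((n : ℝ) - k) * √(((k : ℕ).factorial : ℝ) * ((n - (k + 1)).factorial : ℝ))
      * Real.mul_self_sqrt (by positivity : (0 : ℝ) ≤ (k : ℝ) + 1)
  · exact zero_mul _

theorem occupation_inl (σ : Config N n) (α : Fin N) : occupation σ (Sum.inl α) = (σ α : ℕ) := rfl

theorem occupation_inr (σ : Config N n) (α : Fin N) :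
    occupation σ (Sum.inr α) = n - (σ α : ℕ) := rfl

theorem occupation_update_add_single (σ : Config N n) (α : Fin N) {k : Fin (n + 1)}
    (h : (σ α : ℕ) = k + 1) :
    occupation σ + Finsupp.single (Sum.inr α) 1 =
      occupation (Function.update σ α k) + Finsupp.single (Sum.inl α) 1 := by
  ext i
  rcases i with β | β <;> rcases eq_or_ne β α with rfl | hβ
  · simp [occupation_inl, h]
  · simp [occupation_inl, Function.update_of_ne hβ, hβ.symm]
  · simp [occupation_inr, h]
    omega
  · simp [occupation_inr, Function.update_of_ne hβ, hβ.symm]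

theorem coeff_occupation_fockRaise_single (α : Fin N) (P : Fock N) (σ : Config N n) :
    coeff (occupation σ) (fockRaise (Pi.single α 1) P) =
      ∑ k : Fin (n + 1), if (σ α : ℕ) = k + 1 then
        ((n - k : ℕ) : ℂ) * coeff (occupation (Function.update σ α k)) P else 0 := by
  rw [fockRaise_single_apply]
  rcases Nat.eq_zero_or_pos (σ α : ℕ) with hσ | hσ
  · rw [coeff_X_mul', if_neg (by simp [occupation_inl, hσ])]
    exact (Finset.sum_eq_zero fun k _ => if_neg (by omega)).symm
  · obtain ⟨l, hl⟩ : ∃ l : Fin (n + 1), (σ α : ℕ) = l + 1 :=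
      ⟨⟨(σ α : ℕ) - 1, by omega⟩, (Nat.sub_add_cancel hσ).symm⟩
    rw [Finset.sum_eq_single_of_mem l (Finset.mem_univ l) fun k _ hk =>
        if_neg fun h => hk (Fin.ext (by omega)), if_pos hl,
      coeff_X_mul_pderiv_of_add_eq (occupation_update_add_single σ α hl), occupation_inr,
      Function.update_self]

theorem coeff_occupation_fockLower_single (α : Fin N) (P : Fock N) (σ : Config N n) :
    coeff (occupation σ) (fockLower (Pi.single α 1) P) =
      ∑ k : Fin (n + 1), if (k : ℕ) = σ α + 1 then
        ((k : ℕ) : ℂ) * coeff (occupation (Function.update σ α k)) P else 0 := by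
  rw [fockLower_single_apply]
  rcases (σ α).is_le.eq_or_lt with hσ | hσ
  · rw [coeff_X_mul', if_neg (by simp [occupation_inr, hσ])]
    exact (Finset.sum_eq_zero fun k _ => if_neg (by omega)).symm
  · obtain ⟨l, hl⟩ : ∃ l : Fin (n + 1), (l : ℕ) = σ α + 1 := ⟨⟨σ α + 1, by omega⟩, rfl⟩
    have hocc := occupation_update_add_single (k := σ α) (Function.update σ α l) α
      (by rw [Function.update_self, hl])
    rw [Function.update_idem, Function.update_eq_self] at hocc
    rw [Finset.sum_eq_single_of_mem l (Finset.mem_univ l) fun k _ hk =>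
        if_neg fun h => hk (Fin.ext (by omega)), if_pos hl,
      coeff_X_mul_pderiv_of_add_eq hocc.symm, occupation_inl, Function.update_self]

theorem siteOp_mulVec_fockToStateLin {α : Fin N} {A : Matrix (Fin (n + 1)) (Fin (n + 1)) ℂ}
    {P Q : Fock N}
    (h : ∀ σ : Config N n, ∑ k, A (σ α) k * bosonNorm n k
      * coeff (occupation (Function.update σ α k)) P = coeff (occupation σ) Q * bosonNorm n (σ α)) :
    siteOp α A *ᵥ fockToStateLin N n P = fockToStateLin N n Q := by
  ext σ
  have hprod (k : Fin (n + 1)) : ∏ β, (bosonNorm n (Function.update σ α k β) : ℂ) =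
      bosonNorm n k * ∏ β ∈ Finset.univ.erase α, (bosonNorm n (σ β) : ℂ) := by
    rw [← Finset.mul_prod_erase _ _ (Finset.mem_univ α), Function.update_self]
    exact congrArg _ (Finset.prod_congr rfl fun β hβ => by
      rw [Function.update_of_ne (Finset.ne_of_mem_erase hβ)])
  simp only [siteOp_mulVec, fockToStateLin_apply, hprod]
  rw [← Finset.mul_prod_erase _ _ (Finset.mem_univ α), ← mul_assoc, ← h, Finset.sum_mul]
  exact Finset.sum_congr rfl fun k _ => by ring

theorem siteOp_splusMat_mulVec (α : Fin N) (P : Fock N) :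
    siteOp α (splusMat n) *ᵥ fockToStateLin N n P =
      fockToStateLin N n (fockRaise (Pi.single α 1) P) :=
  siteOp_mulVec_fockToStateLin fun σ => by
    simp only [splusMat_mul_bosonNorm, coeff_occupation_fockRaise_single, Finset.sum_mul, ite_mul,
      zero_mul, mul_right_comm]

theorem siteOp_sminusMat_mulVec (α : Fin N) (P : Fock N) :
    siteOp α (sminusMat n) *ᵥ fockToStateLin N n P =
      fockToStateLin N n (fockLower (Pi.single α 1) P) :=
  siteOp_mulVec_fockToStateLin fun σ => by
    simp only [sminusMat_mul_bosonNorm, coeff_occupation_fockLower_single, Finset.sum_mul, ite_mul,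
      zero_mul, mul_right_comm]

theorem siteOp_szMat_mulVec (α : Fin N) (P : Fock N) :
    siteOp α (szMat n) *ᵥ fockToStateLin N n P =
      fockToStateLin N n (fockSz (Pi.single α 1) P) :=
  siteOp_mulVec_fockToStateLin fun σ => by
    rw [Finset.sum_eq_single_of_mem (σ α) (Finset.mem_univ _) fun k _ hk => by
        rw [szMat, Matrix.diagonal_apply_ne' _ hk, zero_mul, zero_mul],
      Function.update_eq_self, fockSz_single_apply, coeff_smul, coeff_sub, coeff_X_mul_pderiv,
      coeff_X_mul_pderiv, occupation_inl, occupation_inr, szMat, Matrix.diagonal_apply_eq,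
      Nat.cast_sub (σ α).is_le, spin, smul_eq_mul]
    push_cast
    ring

theorem siteSpin_mulVec (α : Fin N) (i : Fin 3) (P : Fock N) :
    siteSpin N n α i *ᵥ fockToStateLin N n P =
      fockToStateLin N n (fockSpin (Pi.single α 1) i P) := by
  have h := map_ofLadder ((Matrix.mulVecBilin ℂ ℂ).flip (fockToStateLin N n P) ∘ₗ
    (siteAlgHom N n α).toLinearMap) (splusMat n) (sminusMat n) (szMat n) i
  rw [← spinMat_eq_ofLadder] at h
  simp only [fockSpin, ofLadder_apply, map_ofLadder, Derivation.coeFn_coe,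
    ← siteOp_splusMat_mulVec, ← siteOp_sminusMat_mulVec, ← siteOp_szMat_mulVec]
  exact h

theorem fockSpin_apply_eq_sum_single (f : Fin N → ℂ) (i : Fin 3) (P : Fock N) :
    fockSpin f i P = ∑ β, f β • fockSpin (Pi.single β 1) i P := by
  simp only [fockSpin, ofLadder_apply, smul_ofLadder_apply, sum_ofLadder_apply,
    Derivation.coeFn_coe, ← bosonOp_eq_sum_single]

theorem weightedSpin_mulVec (f : Fin N → ℂ) (i : Fin 3) (P : Fock N) :
    weightedSpin N n f i *ᵥ fockToStateLin N n P = fockToStateLin N n (fockSpin f i P) := by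
  rw [fockSpin_apply_eq_sum_single, map_sum, weightedSpin_apply, Matrix.sum_mulVec]
  simp only [Matrix.smul_mulVec, siteSpin_mulVec, map_smul]

theorem eq_zero_of_fockToStateLin_eq_zero {P : Fock N}
    (hP : ∀ α, numberOp α P = (n : ℂ) • P) (h : fockToStateLin N n P = 0) : P = 0 := by
  ext m
  rw [coeff_zero]
  by_cases hm : ∀ α, m (Sum.inl α) + m (Sum.inr α) = n
  · have hlt (α : Fin N) : m (Sum.inl α) < n + 1 := by have := hm α; omega
    have hocc : occupation (fun α => (⟨m (Sum.inl α), hlt α⟩ : Fin (n + 1))) = m := by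
      ext (α | α)
      · rfl
      · exact Nat.sub_eq_of_eq_add ((hm α).symm.trans (Nat.add_comm _ _))
    have hcoeff := congrFun h fun α => (⟨m (Sum.inl α), hlt α⟩ : Fin (n + 1))
    rw [fockToStateLin_apply, hocc, Pi.zero_apply] at hcoeff
    exact (mul_eq_zero.1 hcoeff).resolve_right (Finset.prod_ne_zero_iff.2 fun α _ =>
      Complex.ofReal_ne_zero.2 (bosonNorm_ne_zero _ _))
  · obtain ⟨α, hα⟩ := not_forall.1 hm
    have hcoeff := congrArg (coeff m) (hP α)
    rw [numberOp_apply, coeff_add, coeff_X_mul_pderiv, coeff_X_mul_pderiv, coeff_smul,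
      smul_eq_mul, ← add_mul, ← sub_eq_zero, ← sub_mul] at hcoeff
    refine (mul_eq_zero.1 hcoeff).resolve_left fun heq => hα ?_
    exact_mod_cast sub_eq_zero.1 heq

/-! ### The spin liquid state is annihilated -/

theorem dOp_mulVec (α : Fin N) (i : Fin 3) (P : Fock N) :
    dOp N n α i *ᵥ fockToStateLin N n P = fockToStateLin N n ((1 / 2 : ℂ) •
      (topSpinMatrix (spin n) (fockSpin (Pi.single α 1)) *ᵥ fockSpin (siteTheta N α)) i P) := by
  rw [dOp_eq, topSpinMatrix_mulVec, topSpinMatrix_mulVec]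
  simp only [Pi.smul_apply, Pi.add_apply, Pi.sub_apply, cross, dotProduct, Matrix.smul_mulVec,
    Matrix.add_mulVec, Matrix.sub_mulVec, ← Matrix.mulVec_mulVec, Matrix.sum_mulVec,
    weightedSpin_mulVec, siteSpin_mulVec, ← map_smul, ← map_add, ← map_sub, ← map_sum,
    LinearMap.smul_apply, LinearMap.add_apply, LinearMap.sub_apply, Module.End.mul_apply,
    LinearMap.sum_apply]

open scoped ComplexOrder in
/-- The raised state is orthogonal to itself: `‖S⁺ψ‖² = ⟨ψ, S⁻S⁺ψ⟩ = ‖S⁻ψ‖² - 2⟨ψ, S^zψ⟩ = 0`. -/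
theorem fockRaise_one_hsPoly (hN : N ≠ 0) (he : Even N) : fockRaise 1 (hsPoly N) = 0 := by
  have lower (P : Fock N) : (∑ α, siteOp α (sminusMat 1) : Op N 1) *ᵥ fockToStateLin N 1 P =
      fockToStateLin N 1 (fockLower 1 P) := by
    simp only [Matrix.sum_mulVec, siteOp_sminusMat_mulVec, bosonOp_eq_sum_single 1, map_sum,
      Pi.one_apply, one_smul]
  have raise (P : Fock N) : (∑ α, siteOp α (sminusMat 1) : Op N 1)ᴴ *ᵥ fockToStateLin N 1 P =
      fockToStateLin N 1 (fockRaise 1 P) := by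
    simp only [← Matrix.star_eq_conjTranspose, star_sum, star_siteOp, sminusMat]
    simp only [Matrix.star_eq_conjTranspose, Matrix.conjTranspose_conjTranspose, Matrix.sum_mulVec,
      siteOp_splusMat_mulVec, bosonOp_eq_sum_single 1, map_sum, Pi.one_apply, one_smul]
  have lower_raise : fockLower 1 (fockRaise 1 (hsPoly N)) = 0 := by
    have h := fockRaise_fockLower 1 1 (hsPoly N)
    rwa [fockLower_one_hsPoly hN he, mul_one, fockSz_one_hsPoly he, map_zero, smul_zero, add_zero,
      eq_comm] at h
  refine eq_zero_of_fockToStateLin_eq_zero (n := 1) (fun α => ?_) ?_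
  · rw [numberOp_bosonOp, numberOp_hsPoly, Nat.cast_one, one_smul]
  · rw [← raise, ← Matrix.conjTranspose_mul_self_mulVec_eq_zero, Matrix.conjTranspose_conjTranspose,
      ← Matrix.mulVec_mulVec, raise, lower, lower_raise, map_zero]

theorem tripletContraction_siteTheta_hsPoly (he : Even N) (α : Fin N) :
    tripletContraction α (siteTheta N α) (hsPoly N) = 0 :=
  tripletContraction_eq_zero (siteTheta_self α) (numberOp_hsPoly α)
    (fockRaise_one_hsPoly α.pos.ne' he) (fockLower_siteTheta_pderiv_hsPoly he α)

theorem numberOp_hsPoly_pow (k : ℕ) (α : Fin N) :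
    numberOp α (hsPoly N ^ k) = (k : ℂ) • hsPoly N ^ k := by
  rw [Derivation.leibniz_pow, numberOp_hsPoly, smul_eq_mul, Nat.cast_smul_eq_nsmul]
  cases k with
  | zero => simp
  | succ k => rw [Nat.add_sub_cancel, pow_succ]

theorem dOp_mulVec_psi0 (he : Even N) (n : ℕ) (α : Fin N) (i : Fin 3) :
    dOp N n α i *ᵥ psi0 N n = 0 := by
  have hW : tripletContraction α (siteTheta N α) (hsPoly N ^ n) = 0 := by
    rw [Derivation.leibniz_pow, tripletContraction_siteTheta_hsPoly he, smul_zero, smul_zero]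
  rw [psi0_eq, dOp_mulVec, topSpinMatrix_fockSpin_mulVec_apply _ (numberOp_hsPoly_pow n α), hW]
  fin_cases i <;> simp [ofLadder]

theorem totalSpin_mulVec_psi0 (hN : N ≠ 0) (he : Even N) (n : ℕ) (i : Fin 3) :
    totalSpin N n i *ᵥ psi0 N n = 0 := by
  have hpow (M : Matrix (Fin 2) (Fin 2) ℂ) (h : bosonOp 1 M (hsPoly N) = 0) :
      bosonOp 1 M (hsPoly N ^ n) = 0 := by
    rw [Derivation.leibniz_pow, h, smul_zero, smul_zero]
  rw [psi0_eq, totalSpin_eq_weightedSpin, weightedSpin_mulVec, fockSpin, ofLadder_apply]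
  simp only [Derivation.coeFn_coe, hpow _ (fockRaise_one_hsPoly hN he),
    hpow _ (fockLower_one_hsPoly hN he), hpow _ (fockSz_one_hsPoly he)]
  fin_cases i <;> simp [ofLadder]

theorem psi0_ne_zero (N n : ℕ) : psi0 N n ≠ 0 := fun h =>
  pow_ne_zero n (hsPoly_ne_zero N) (eq_zero_of_fockToStateLin_eq_zero (numberOp_hsPoly_pow n) h)

end FockToState

/-! ### The ground state -/

section GroundState

open scoped ComplexOrder

variable {N n : ℕ}

theorem posSemidef_totalSpin_dotProduct_self (N n : ℕ) :
    (totalSpin N n ⬝ᵥ totalSpin N n).PosSemidef := by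
  have hstar (i : Fin 3) : (totalSpin N n i)ᴴ = totalSpin N n i := by
    rw [totalSpin_eq_weightedSpin, ← Matrix.star_eq_conjTranspose, ← Pi.star_apply,
      star_weightedSpin, star_one]
  refine Matrix.posSemidef_sum _ fun i _ => ?_
  simpa only [hstar] using Matrix.posSemidef_conjTranspose_mul_self (totalSpin N n i)

theorem posSemidef_hTilde_sub (n : ℕ) (hN : 2 ≤ N) :
    (hTilde N n - ((eTilde N n : ℝ) : ℂ) • (1 : Op N n)).PosSemidef := by
  have hN' : 0 ≤ (N : ℝ) - 2 := sub_nonneg.2 (by exact_mod_cast hN)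
  have hs : 0 ≤ spin n := by rw [spin]; positivity
  rw [← sum_dDaggerD_add_totalSpin_sq (by omega)]
  have hD : (∑ α, dDaggerD N n α).PosSemidef :=
    Matrix.posSemidef_sum _ fun α _ => Matrix.posSemidef_sum _ fun i _ =>
      Matrix.posSemidef_conjTranspose_mul_self _
  exact ((hD.smul (Complex.zero_le_real.2 (by positivity))).add
    ((posSemidef_totalSpin_dotProduct_self N n).smul (Complex.zero_le_real.2 (by positivity)))).smul
    (Complex.zero_le_real.2 (by positivity))

theorem isGroundState_of_posSemidef {H : Op N n} {E : ℝ} {v : State N n}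
    (hH : (H - (E : ℂ) • (1 : Op N n)).PosSemidef) (hv : v ≠ 0)
    (hE : (H - (E : ℂ) • (1 : Op N n)) *ᵥ v = 0) : IsGroundState H E v := by
  have hEH : ((E : ℂ) • (1 : Op N n)).IsHermitian :=
    Matrix.isHermitian_one.smul (Complex.conj_ofReal E)
  refine ⟨by simpa only [sub_add_cancel] using hH.isHermitian.add hEH, hv, ?_, fun μ hμ => ?_⟩
  · rwa [Matrix.sub_mulVec, sub_eq_zero, Matrix.smul_mulVec, Matrix.one_mulVec] at hE
  · obtain ⟨w, hw⟩ := hμ.exists_hasEigenvector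
    have hHw : H *ᵥ w = (μ : ℂ) • w := (Matrix.toLin'_apply H w).symm.trans hw.apply_eq_smul
    have expectation := hH.dotProduct_mulVec_nonneg w
    rw [Matrix.sub_mulVec, Matrix.smul_mulVec, Matrix.one_mulVec, hHw, ← sub_smul,
      dotProduct_smul, ← Complex.ofReal_sub, smul_eq_mul] at expectation
    have norm_pos : 0 < star w ⬝ᵥ w := Matrix.dotProduct_star_self_pos_iff.2 hw.2
    exact sub_nonneg.1 (Complex.zero_le_real.1
      (le_of_mul_le_mul_right ((zero_mul _).trans_le expectation) norm_pos))

theorem hTilde_sub_mulVec_psi0 (hN : N ≠ 0) (he : Even N) (n : ℕ) :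
    (hTilde N n - ((eTilde N n : ℝ) : ℂ) • (1 : Op N n)) *ᵥ psi0 N n = 0 := by
  rw [← sum_dDaggerD_add_totalSpin_sq hN]
  simp only [Matrix.smul_mulVec, Matrix.add_mulVec, Matrix.sum_mulVec, dDaggerD, dotProduct,
    ← Matrix.mulVec_mulVec, dOp_mulVec_psi0 he, totalSpin_mulVec_psi0 hN he, Matrix.mulVec_zero,
    Finset.sum_const_zero, smul_zero, add_zero]

end GroundState

end SpinChain

end

theorem mainTheorem5 (N n : ℕ) (hN : 1 ≤ N) :
    (((2 * Real.pi ^ 2 / (N : ℝ) ^ 2 : ℝ) : ℂ) •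
        (((1 / ((2 * SpinChain.spin n + 1) * (2 * SpinChain.spin n + 3)) : ℝ) : ℂ) •
            ∑ α, SpinChain.dDaggerD N n α
          + (((SpinChain.spin n + 1) * ((N : ℝ) - 2) / (4 * (2 * SpinChain.spin n + 3)) : ℝ) : ℂ) •
            (SpinChain.totalSpin N n ⬝ᵥ SpinChain.totalSpin N n))
      = SpinChain.hTilde N n - ((SpinChain.eTilde N n : ℝ) : ℂ) • (1 : SpinChain.Op N n)) ∧
    (Even N →
      SpinChain.IsGroundState (SpinChain.hTilde N n) (SpinChain.eTilde N n)
        (SpinChain.psi0 N n)) := by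
  have hN0 : N ≠ 0 := Nat.one_le_iff_ne_zero.1 hN
  refine ⟨SpinChain.sum_dDaggerD_add_totalSpin_sq hN0, fun he => ?_⟩
  have hN2 : 2 ≤ N := by
    obtain ⟨M, hM⟩ := he
    omega
  exact SpinChain.isGroundState_of_posSemidef (SpinChain.posSemidef_hTilde_sub n hN2)
    (SpinChain.psi0_ne_zero N n) (SpinChain.hTilde_sub_mulVec_psi0 hN0 he n)
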